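/- Let $X$ and $Y$ be simply connected, complete, homogeneous Riemannian manifolds (finite-dimensional, smooth, without boundary, with their Riemannian distances; homogeneous means that the isometry group acts transitively). Suppose that $X$ is quasi-isometric to $Y$, i.e. there are a map $\psi:X\to Y$ and constants $K\ge 1$, $c\ge 0$ such that $K^{-1}d(x,x')-c\le d(\psi(x),\psi(x'))\le K\,d(x,x')+c$ for all $x,x'\in X$ and every point of $Y$ is within distance $c$ of $\psi(X)$. For a metric space $Z$ and a loop $\gamma:S^1\to Z$, where $S^1\subset D^2\subset\mathbb{C}$ are the unit circle and the closed unit disk with the Euclidean metric, let $$\operatorname{Span}(\gamma)=\inf\{\operatorname{Lip}(f)\mid f:D^2\to Z,\ f|_{S^1}=\gamma\}\in[0,\infty],$$ where $\operatorname{Lip}(f)\in[0,\infty]$ is the optimal Lipschitz constant of $f$ (with value $\infty$ if $f$ is not Lipschitz). Call $Z$ Lipschitz 1-connected if there is a constant $C<\infty$ such that $\operatorname{Span}(\gamma)\le C\operatorname{Lip}(\gamma)$ for all Lipschitz loops $\gamma:S^1\to Z$. If $Y$ is Lipschitz 1-connected, then so is $X$. -/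

import Mathlib

open scoped NNReal ENNReal Manifold ContDiff Bundle

/-- A metric space is homogeneous if its group of isometries acts transitively. In particular this
holds as soon as some (Lie) group acts transitively by isometries; see
`IsHomogeneousMetricSpace.of_action`. -/
def IsHomogeneousMetricSpace (X : Type*) [MetricSpace X] : Prop :=
  ∀ x y : X, ∃ e : X ≃ᵢ X, e x = y

theorem IsHomogeneousMetricSpace.of_action (G X : Type*) [Group G] [MetricSpace X] [MulAction G X]
    [IsIsometricSMul G X] [MulAction.IsPretransitive G X] : IsHomogeneousMetricSpace X := by
  intro x y
  obtain ⟨g, hg⟩ := MulAction.exists_smul_eq G x y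
  exact ⟨IsometryEquiv.constSMul g, hg⟩

/-- `f` is a quasi-isometry: a coarsely bilipschitz map with coarsely dense image. -/
def IsQuasiIsometry {X Y : Type*} [MetricSpace X] [MetricSpace Y] (f : X → Y) : Prop :=
  ∃ K C : ℝ, 1 ≤ K ∧ 0 ≤ C ∧
    (∀ x x' : X, K⁻¹ * dist x x' - C ≤ dist (f x) (f x') ∧
      dist (f x) (f x') ≤ K * dist x x' + C) ∧
    ∀ y : Y, ∃ x : X, dist (f x) y ≤ C

/-- `X` is quasi-isometric to `Y`. -/
def QuasiIsometric (X Y : Type*) [MetricSpace X] [MetricSpace Y] : Prop :=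
  ∃ f : X → Y, IsQuasiIsometry f

/-- The unit circle, with the metric induced from `ℂ`. -/
abbrev UnitCircle : Type := Metric.sphere (0 : ℂ) 1

/-- The closed unit disk, with the Euclidean metric. -/
abbrev UnitDisk : Type := Metric.closedBall (0 : ℂ) 1

/-- The inclusion of the unit circle in the closed unit disk. -/
def circleToDisk : UnitCircle → UnitDisk :=
  Set.inclusion Metric.sphere_subset_closedBall

/-- The optimal Lipschitz constant of `f`; it is `∞` if `f` is not Lipschitz. -/
noncomputable def lipConst {A B : Type*} [MetricSpace A] [MetricSpace B] (f : A → B) : ℝ≥0∞ :=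
  ⨅ (K : ℝ≥0) (_ : LipschitzWith K f), (K : ℝ≥0∞)

/-- The filling span of a loop: the infimum of the Lipschitz constants of the maps from the disk
that restrict to the loop on the circle; it is `∞` if there is no Lipschitz filling. -/
noncomputable def fillingSpan {X : Type*} [MetricSpace X] (γ : UnitCircle → X) : ℝ≥0∞ :=
  ⨅ (f : UnitDisk → X) (_ : f ∘ circleToDisk = γ), lipConst f

/-- `X` is Lipschitz 1-connected: the filling span of every Lipschitz loop is at most a fixed
finite multiple of its Lipschitz constant. -/
def LipschitzOneConnected (X : Type*) [MetricSpace X] : Prop :=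
  ∃ C : ℝ≥0, ∀ γ : UnitCircle → X, (∃ K : ℝ≥0, LipschitzWith K γ) →
    fillingSpan γ ≤ C * lipConst γ

/-!
A loop of `X` at a large scale is carried to `Y` by the quasi-isometry, filled there with a linear
Lipschitz bound, and the filling is carried back by a quasi-inverse. The result is only coarsely
Lipschitz and only close to the loop on the boundary, so keep its values at the points of a unit
grid, join neighbouring points by short paths, and fill the resulting loops of bounded length
around the cells.

Loops of bounded length in `X` have fillings with a uniform Lipschitz bound. By homogeneity they may
be taken through a fixed point, by the Arzelà–Ascoli theorem finitely many of them approximate all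
the others, and simple connectivity fills these finitely many. A loop close to a filled one differs
from it by an annulus of very short loops, which are filled in a chart. Charts are bilipschitz near
a point, so that short loops have linear fillings, uniformly by homogeneity again.

Fillings are sought on the square `[-1, 1]²`, which can be cut into cells, rather than on the disk;
rescaling along the rays from the origin compares the two.
-/

open Set Metric Topology Filter

/-- A length space, in the form used here: two points at distance less than `ℓ` are joined by an
`ℓ`-Lipschitz path parametrized by the unit interval (and extended to the real line, which avoids
subtypes). -/
def IsLengthSpace (X : Type*) [MetricSpace X] : Prop :=
  ∀ (x y : X) (ℓ : ℝ≥0), dist x y < ℓ → ∃ p : ℝ → X, LipschitzWith ℓ p ∧ p 0 = x ∧ p 1 = y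

section RiemannianLengthSpace

open MeasureTheory Manifold

theorem exists_lipschitzWith_of_dist_le_dist {X : Type*} [MetricSpace X] {γ : ℝ → X} {s : ℝ → ℝ}
    (hs : ContinuousOn s (Icc 0 1)) (hs0 : s 0 = 0) (hs1 : 0 ≤ s 1)
    (hd : ∀ a ∈ Icc (0 : ℝ) 1, ∀ b ∈ Icc (0 : ℝ) 1, dist (γ a) (γ b) ≤ dist (s a) (s b))
    {ℓ : ℝ≥0} (hℓ : s 1 ≤ ℓ) :
    ∃ p : ℝ → X, LipschitzWith ℓ p ∧ p 0 = γ 0 ∧ p 1 = γ 1 := by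
  have exists_inverse (u : ℝ) :
      ∃ t ∈ Icc (0 : ℝ) 1, s t = s 1 * projIcc (0 : ℝ) 1 zero_le_one u := by
    obtain ⟨h0, h1⟩ := (projIcc (0 : ℝ) 1 zero_le_one u).2
    exact intermediate_value_Icc zero_le_one hs
      ⟨hs0.symm ▸ mul_nonneg hs1 h0, mul_le_of_le_one_right hs1 h1⟩
  choose τ hτ hsτ using exists_inverse
  have endpoint {u t : ℝ} (ht : t ∈ Icc (0 : ℝ) 1) (h : s (τ u) = s t) : γ (τ u) = γ t :=
    dist_le_zero.1 ((hd _ (hτ u) _ ht).trans_eq (by rw [h, dist_self]))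
  refine ⟨γ ∘ τ, LipschitzWith.of_dist_le_mul fun u v ↦ ?_,
    endpoint (left_mem_Icc.2 zero_le_one) (by simp [hsτ, hs0]),
    endpoint (right_mem_Icc.2 zero_le_one) (by simp [hsτ])⟩
  calc dist (γ (τ u)) (γ (τ v)) ≤ dist (s (τ u)) (s (τ v)) := hd _ (hτ u) _ (hτ v)
    _ = s 1 * dist (projIcc (0 : ℝ) 1 zero_le_one u) (projIcc (0 : ℝ) 1 zero_le_one v) := by
      rw [hsτ, hsτ, Real.dist_eq, ← mul_sub, abs_mul, abs_of_nonneg hs1, Subtype.dist_eq,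
        Real.dist_eq]
    _ ≤ ℓ * dist u v := by
      gcongr
      simpa using (LipschitzWith.projIcc (zero_le_one' ℝ)).dist_le_mul u v

variable {E : Type*} [NormedAddCommGroup E] [NormedSpace ℝ E]
  {H : Type*} [TopologicalSpace H] {I : ModelWithCorners ℝ E H}

section

variable {M : Type*} [TopologicalSpace M] [ChartedSpace H M]
  [∀ x : M, ENorm (TangentSpace I x)]

theorem dist_toReal_pathELength {γ : ℝ → M} {a b s t : ℝ} (h : pathELength I γ a b ≠ ⊤)
    (hs : s ∈ Icc a b) (ht : t ∈ Icc a b) :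
    dist (pathELength I γ a s).toReal (pathELength I γ a t).toReal =
      (pathELength I γ (min s t) (max s t)).toReal := by
  wlog hst : s ≤ t generalizing s t
  · rw [dist_comm, min_comm, max_comm]
    exact this ht hs (le_of_not_ge hst)
  have hfin {c d : ℝ} (hc : a ≤ c) (hd : d ≤ b) : pathELength I γ c d ≠ ⊤ :=
    ne_top_of_le_ne_top h (pathELength_mono hc hd)
  rw [min_eq_left hst, max_eq_right hst, dist_comm, Real.dist_eq, ← pathELength_add hs.1 hst,
    ENNReal.toReal_add (hfin le_rfl hs.2) (hfin hs.1 ht.2), add_sub_cancel_left,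
    abs_of_nonneg ENNReal.toReal_nonneg]

theorem continuousOn_toReal_pathELength {γ : ℝ → M} {a b : ℝ} (h : pathELength I γ a b ≠ ⊤) :
    ContinuousOn (fun t ↦ (pathELength I γ a t).toReal) (Icc a b) := by
  intro t ht
  have hvol : Tendsto (fun s ↦ volume.restrict (Icc a b) (uIcc s t)) (𝓝[Icc a b] t) (𝓝 0) := by
    have hlen : Tendsto (fun s ↦ ENNReal.ofReal |t - s|) (𝓝[Icc a b] t) (𝓝 0) := by
      have : Continuous fun s ↦ ENNReal.ofReal |t - s| :=
        ENNReal.continuous_ofReal.comp (by fun_prop)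
      simpa using this.continuousWithinAt.tendsto (x := t) (s := Icc a b)
    refine tendsto_of_tendsto_of_tendsto_of_le_of_le tendsto_const_nhds hlen
      (fun _ ↦ zero_le) fun s ↦ ?_
    exact (Measure.restrict_le_self _).trans_eq Real.volume_interval
  rw [pathELength_eq_lintegral_mfderiv_Icc] at h
  have hint := (ENNReal.tendsto_toReal ENNReal.zero_ne_top).comp
    (tendsto_setLIntegral_zero h hvol)
  refine tendsto_iff_dist_tendsto_zero.2 (hint.congr' ?_)
  filter_upwards [self_mem_nhdsWithin] with s hs
  rw [← pathELength_eq_lintegral_mfderiv_Icc] at h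
  rw [dist_toReal_pathELength h hs ht, pathELength_eq_lintegral_mfderiv_Icc, Function.comp_apply,
    Measure.restrict_restrict measurableSet_uIcc, inter_eq_left.2 (uIcc_subset_Icc hs ht), uIcc]

end

variable {M : Type*} [MetricSpace M] [ChartedSpace H M]
  [Bundle.RiemannianBundle (fun x : M ↦ TangentSpace I x)]

theorem edist_le_pathELength [IsRiemannianManifold I M] {γ : ℝ → M} {a b : ℝ}
    (hγ : CMDiff[Icc a b] 1 γ) (hab : a ≤ b) :
    edist (γ a) (γ b) ≤ pathELength I γ a b := by
  rw [IsRiemannianManifold.out (I := I) (γ a) (γ b)]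
  exact riemannianEDist_le_pathELength hγ rfl rfl hab

variable (I M) in
theorem isLengthSpace_of_isRiemannianManifold [IsRiemannianManifold I M] :
    IsLengthSpace M := by
  intro x y ℓ hxy
  have hxy' : riemannianEDist I x y < ℓ := by
    rwa [← IsRiemannianManifold.out (I := I) x y, edist_lt_coe, ← NNReal.coe_lt_coe, coe_nndist]
  obtain ⟨γ, rfl, rfl, hγ, hlen⟩ := exists_lt_of_riemannianEDist_lt hxy'
  refine exists_lipschitzWith_of_dist_le_dist (continuousOn_toReal_pathELength hlen.ne_top)
    (by simp) ENNReal.toReal_nonneg (fun a ha b hb ↦ ?_)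
    (by simpa using ENNReal.toReal_mono ENNReal.coe_ne_top hlen.le)
  rw [dist_toReal_pathELength hlen.ne_top ha hb]
  have hsub : uIcc a b ⊆ Icc 0 1 := uIcc_subset_Icc ha hb
  have hfin : pathELength I γ (min a b) (max a b) ≠ ⊤ :=
    ne_top_of_le_ne_top hlen.ne_top (pathELength_mono (le_min ha.1 hb.1) (max_le ha.2 hb.2))
  have := ENNReal.toReal_mono hfin (edist_le_pathELength (hγ.mono hsub) min_le_max)
  rcases le_total a b with hab | hab
  · simpa [hab, dist_edist] using this
  · simpa [hab, dist_edist, edist_comm] using this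

end RiemannianLengthSpace

section Chart

open MeasureTheory Manifold

variable {E : Type*} [NormedAddCommGroup E] [NormedSpace ℝ E]
  {H : Type*} [TopologicalSpace H] {I : ModelWithCorners ℝ E H}

section

variable {M : Type*} [TopologicalSpace M] [ChartedSpace H M] [∀ x : M, ENorm (TangentSpace I x)]
  {E' : Type*} [NormedAddCommGroup E'] [NormedSpace ℝ E']
  {H' : Type*} [TopologicalSpace H'] {I' : ModelWithCorners ℝ E' H'}
  {M' : Type*} [TopologicalSpace M'] [ChartedSpace H' M'] [∀ x : M', ENorm (TangentSpace I' x)]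

theorem pathELength_comp_le {f : M → M'} {γ : ℝ → M} {a b : ℝ} {C : ℝ≥0}
    (hf : ∀ t ∈ Ioo a b, MDiffAt f (γ t)) (hγ : ∀ t ∈ Ioo a b, MDiffAt γ t)
    (hC : ∀ t ∈ Ioo a b, ∀ v : TangentSpace I (γ t), ‖mfderiv I I' f (γ t) v‖ₑ ≤ C * ‖v‖ₑ) :
    pathELength I' (f ∘ γ) a b ≤ C * pathELength I γ a b := by
  rw [pathELength_eq_lintegral_mfderiv_Ioo, pathELength_eq_lintegral_mfderiv_Ioo,
    ← lintegral_const_mul' _ _ ENNReal.coe_ne_top]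
  refine setLIntegral_mono' measurableSet_Ioo fun t ht ↦ ?_
  rw [mfderiv_comp t (hf t ht) (hγ t ht)]
  exact hC t ht _

end

attribute [local instance] normedAddCommGroupTangentSpaceVectorSpace
attribute [local instance] normedSpaceTangentSpaceVectorSpace

theorem edist_le_pathELength_normedSpace {γ : ℝ → E} {a b : ℝ} (hγ : ContDiffOn ℝ 1 γ (Icc a b))
    (hab : a ≤ b) : edist (γ a) (γ b) ≤ pathELength 𝓘(ℝ, E) γ a b := by
  rw [edist_comm, edist_eq_enorm_sub, pathELength_eq_lintegral_mfderivWithin_Icc]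
  refine (enorm_sub_le_lintegral_derivWithin_Icc_of_contDiffOn_Icc hγ hab).trans_eq ?_
  simp_rw [← fderivWithin_derivWithin, mfderivWithin_eq_fderivWithin]
  rfl

theorem pathELength_lineMap (x y : E) :
    pathELength 𝓘(ℝ, E) (ContinuousAffineMap.lineMap (R := ℝ) x y) 0 1 = edist x y := by
  rw [← lintegral_fderiv_lineMap_eq_edist, pathELength_eq_lintegral_mfderivWithin_Icc]
  simp_rw [mfderivWithin_eq_fderivWithin]
  rfl

variable {M : Type*} [MetricSpace M] [ChartedSpace H M]
  [Bundle.RiemannianBundle (fun x : M ↦ TangentSpace I x)] [IsRiemannianManifold I M]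

theorem lipschitzOnWith_of_convex_of_enorm_mfderiv_le {f : E → M} {s : Set E} {C : ℝ≥0}
    (hs : Convex ℝ s) (hso : IsOpen s) (hf : CMDiff[s] 1 f)
    (hC : ∀ y ∈ s, ∀ v : TangentSpace 𝓘(ℝ, E) y, ‖mfderiv 𝓘(ℝ, E) I f y v‖ₑ ≤ C * ‖v‖ₑ) :
    LipschitzOnWith C f s := by
  intro y hy z hz
  have hseg : MapsTo (ContinuousAffineMap.lineMap (R := ℝ) y z) (Icc 0 1) s := by
    rw [mapsTo_iff_image_subset, ContinuousAffineMap.coe_lineMap_eq, ← segment_eq_image_lineMap]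
    exact hs.segment_subset hy hz
  have hline : ContMDiff 𝓘(ℝ, ℝ) 𝓘(ℝ, E) 1 (ContinuousAffineMap.lineMap (R := ℝ) y z) :=
    (ContinuousAffineMap.contDiff _).contMDiff
  have hmem {t : ℝ} (ht : t ∈ Ioo (0 : ℝ) 1) := hseg (Ioo_subset_Icc_self ht)
  calc edist (f y) (f z)
      ≤ pathELength I (f ∘ ContinuousAffineMap.lineMap (R := ℝ) y z) 0 1 := by
        simpa [ContinuousAffineMap.coe_lineMap_eq] using
          edist_le_pathELength (I := I) (hf.comp hline.contMDiffOn hseg) zero_le_one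
    _ ≤ C * pathELength 𝓘(ℝ, E) (ContinuousAffineMap.lineMap (R := ℝ) y z) 0 1 :=
      pathELength_comp_le
        (fun t ht ↦ (hf.contMDiffAt (hso.mem_nhds (hmem ht))).mdifferentiableAt one_ne_zero)
        (fun t _ ↦ hline.mdifferentiable one_ne_zero t) fun t ht ↦ hC _ (hmem ht)
    _ = C * edist y z := by rw [pathELength_lineMap]

theorem lipschitzOnWith_of_enorm_mfderiv_le {f : M → E} {x : M} {r : ℝ} {C : ℝ≥0}
    (hf : CMDiff[ball x (3 * r)] 1 f)
    (hC : ∀ y ∈ ball x (3 * r), ∀ v : TangentSpace I y,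
      ‖mfderiv I 𝓘(ℝ, E) f y v‖ₑ ≤ C * ‖v‖ₑ) :
    LipschitzOnWith C f (ball x r) := by
  intro y hy z hz
  rw [mem_ball] at hy hz
  suffices H : ∀ ℓ : ℝ≥0∞, edist y z < ℓ → ℓ < ENNReal.ofReal (2 * r) →
      edist (f y) (f z) ≤ C * ℓ by
    have hyz : edist y z < ENNReal.ofReal (2 * r) := by
      rw [edist_dist, ENNReal.ofReal_lt_ofReal_iff (by linarith [dist_nonneg (x := y) (y := x)])]
      linarith [dist_triangle_right y z x]
    have hlim : Tendsto (fun ℓ : ℝ≥0∞ ↦ C * ℓ) (𝓝[>] (edist y z)) (𝓝 (C * edist y z)) :=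
      ((ENNReal.continuous_const_mul ENNReal.coe_ne_top).tendsto _).mono_left nhdsWithin_le_nhds
    have := nhdsGT_neBot_of_exists_gt ⟨_, hyz⟩
    refine ge_of_tendsto hlim ?_
    filter_upwards [Ioo_mem_nhdsGT hyz] with ℓ hℓ using H ℓ hℓ.1 hℓ.2
  intro ℓ hℓ hℓr
  rw [IsRiemannianManifold.out (I := I)] at hℓ
  obtain ⟨γ, rfl, rfl, hγ, hlen, -⟩ := exists_lt_locally_constant_of_riemannianEDist_lt hℓ one_pos
  -- A path from `y` of length less than `2 * r` stays in the larger ball.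
  have hmem : MapsTo γ (Icc 0 1) (ball x (3 * r)) := by
    intro t ht
    have h : edist (γ 0) (γ t) < ENNReal.ofReal (2 * r) :=
      ((edist_le_pathELength (I := I) hγ.contMDiffOn ht.1).trans
        (pathELength_mono le_rfl ht.2)).trans_lt (hlen.trans hℓr)
    rw [edist_dist, ENNReal.ofReal_lt_ofReal_iff (by linarith [dist_nonneg (x := γ 0) (y := x)])]
      at h
    rw [mem_ball]
    linarith [dist_triangle_left (γ t) x (γ 0)]
  calc edist (f (γ 0)) (f (γ 1)) ≤ pathELength 𝓘(ℝ, E) (f ∘ γ) 0 1 :=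
        edist_le_pathELength_normedSpace (hf.comp hγ.contMDiffOn hmem).contDiffOn zero_le_one
    _ ≤ C * pathELength I γ 0 1 :=
      pathELength_comp_le
        (fun t ht ↦ (hf.contMDiffAt (isOpen_ball.mem_nhds
          (hmem (Ioo_subset_Icc_self ht)))).mdifferentiableAt one_ne_zero)
        (fun t _ ↦ hγ.mdifferentiable one_ne_zero t)
        fun t ht ↦ hC _ (hmem (Ioo_subset_Icc_self ht))
    _ ≤ C * ℓ := by gcongr

variable [IsManifold I 1 M] [IsContinuousRiemannianBundle E (fun x : M ↦ TangentSpace I x)]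

variable (I)

theorem exists_lipschitzOnWith_extChartAt_symm [I.Boundaryless] (x : M) :
    ∃ C : ℝ≥0, ∃ r > 0, ball (extChartAt I x x) r ⊆ (extChartAt I x).target ∧
      LipschitzOnWith C (extChartAt I x).symm (ball (extChartAt I x x) r) := by
  obtain ⟨C, -, hC⟩ := eventually_enorm_mfderivWithin_symm_extChartAt_lt I x
  rw [I.range_eq_univ, nhdsWithin_univ] at hC
  obtain ⟨r, hr, hball⟩ := Metric.mem_nhds_iff.1 (inter_mem (extChartAt_target_mem_nhds x) hC)
  have htarget : ball (extChartAt I x x) r ⊆ (extChartAt I x).target :=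
    hball.trans inter_subset_left
  refine ⟨C, r, hr, htarget, lipschitzOnWith_of_convex_of_enorm_mfderiv_le (I := I)
    (convex_ball _ _) isOpen_ball ((contMDiffOn_extChartAt_symm x).mono htarget) fun y hy v ↦ ?_⟩
  rw [← mfderivWithin_univ]
  exact (ContinuousLinearMap.le_opENorm _ v).trans (mul_le_mul_left (hball hy).2.le _)

theorem exists_lipschitzOnWith_extChartAt (x : M) :
    ∃ C : ℝ≥0, ∃ r > 0, ball x r ⊆ (extChartAt I x).source ∧
      LipschitzOnWith C (extChartAt I x) (ball x r) := by
  obtain ⟨C, -, hC⟩ := eventually_enorm_mfderiv_extChartAt_lt I x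
  obtain ⟨r, hr, hball⟩ := Metric.mem_nhds_iff.1
    (inter_mem (extChartAt_source_mem_nhds (I := I) x) hC)
  have hsource : ball x r ⊆ (extChartAt I x).source := hball.trans inter_subset_left
  rw [← mul_div_cancel₀ r (three_ne_zero' ℝ)] at hball
  refine ⟨C, r / 3, by positivity, (ball_subset_ball (by linarith)).trans hsource,
    lipschitzOnWith_of_enorm_mfderiv_le (I := I) (contMDiffOn_extChartAt.mono fun y hy ↦ ?_)
      fun y hy v ↦ ?_⟩
  · exact extChartAt_source I x ▸ (hball hy).1
  · exact (ContinuousLinearMap.le_opENorm _ v).trans (mul_le_mul_left (hball hy).2.le _)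

end Chart

/-- The nearest-point retraction of the plane onto the square `[-a, a]²`, which is the closed ball
of radius `a` for the supremum norm of `ℝ × ℝ`; accordingly the boundary of that square is written
`sphere 0 a`. -/
noncomputable def clampSquare (a : ℝ) (p : ℝ × ℝ) : ℝ × ℝ :=
  (max (-a) (min a p.1), max (-a) (min a p.2))

namespace clampSquare

variable {a : ℝ} {p : ℝ × ℝ}

theorem lipschitzWith (a : ℝ) : LipschitzWith 1 (clampSquare a) := by
  simpa using! ((LipschitzWith.prod_fst.const_min a).const_max (-a)).prodMk
    ((LipschitzWith.prod_snd.const_min a).const_max (-a))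

theorem eq_self (h : ‖p‖ ≤ a) : clampSquare a p = p := by
  obtain ⟨h1, h2⟩ := norm_prod_le_iff.1 h
  obtain ⟨h1, h1'⟩ := abs_le.1 h1
  obtain ⟨h2, h2'⟩ := abs_le.1 h2
  simp [clampSquare, *]

theorem norm_eq (ha : 0 ≤ a) (p : ℝ × ℝ) : ‖clampSquare a p‖ = min a ‖p‖ := by
  have abs_clamp (x : ℝ) : |max (-a) (min a x)| = min a |x| := by grind
  simp only [clampSquare, Prod.norm_def, Real.norm_eq_abs, abs_clamp, min_max_distrib_left]

theorem mem_sphere (ha : 0 ≤ a) (h : a ≤ ‖p‖) : clampSquare a p ∈ sphere 0 a := by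
  rw [mem_sphere_zero_iff_norm, norm_eq ha, min_eq_left h]

end clampSquare

section Gluing

variable {X : Type*} [PseudoMetricSpace X] {K : ℝ≥0}

theorem lipschitzOnWith_Icc_of_Icc_of_Icc {f : ℝ → X} {a b c : ℝ}
    (hab : LipschitzOnWith K f (Icc a b)) (hbc : LipschitzOnWith K f (Icc b c)) :
    LipschitzOnWith K f (Icc a c) := by
  refine LipschitzOnWith.of_dist_le_mul fun x hx y hy ↦ ?_
  wlog hxy : x ≤ y generalizing x y
  · rw [dist_comm, dist_comm x]
    exact this y hy x hx (le_of_not_ge hxy)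
  rcases le_total y b with hyb | hby
  · exact hab.dist_le_mul x ⟨hx.1, hxy.trans hyb⟩ y ⟨hy.1, hyb⟩
  rcases le_total b x with hbx | hxb
  · exact hbc.dist_le_mul x ⟨hbx, hx.2⟩ y ⟨hby, hy.2⟩
  calc dist (f x) (f y) ≤ dist (f x) (f b) + dist (f b) (f y) := dist_triangle _ _ _
    _ ≤ K * dist x b + K * dist b y :=
      add_le_add (hab.dist_le_mul x ⟨hx.1, hxb⟩ b ⟨hx.1.trans hxb, le_rfl⟩)
        (hbc.dist_le_mul b ⟨le_rfl, hby.trans hy.2⟩ y ⟨hby, hy.2⟩)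
    _ = K * dist x y := by
      rw [← mul_add, Real.dist_eq, Real.dist_eq, Real.dist_eq, abs_of_nonpos (by linarith),
        abs_of_nonpos (by linarith), abs_of_nonpos (by linarith)]
      ring

theorem lipschitzWith_of_forall_Icc_int {f : ℝ → X}
    (h : ∀ k : ℤ, LipschitzOnWith K f (Icc k (k + 1))) : LipschitzWith K f := by
  have hnat (k : ℤ) (n : ℕ) : LipschitzOnWith K f (Icc k (k + n)) := by
    induction n with
    | zero => simp [LipschitzOnWith]
    | succ n ih =>
      refine lipschitzOnWith_Icc_of_Icc_of_Icc ih ?_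
      simpa [add_assoc] using h (k + n)
  rw [← lipschitzOnWith_univ]
  intro x _ y _
  obtain ⟨n, hn⟩ := exists_nat_ge (max x y - ⌊min x y⌋)
  have hmem {z : ℝ} (h1 : min x y ≤ z) (h2 : z ≤ max x y) :
      z ∈ Icc (⌊min x y⌋ : ℝ) (⌊min x y⌋ + n) :=
    ⟨(Int.floor_le _).trans h1, by linarith⟩
  exact hnat ⌊min x y⌋ n (hmem (min_le_left _ _) (le_max_left _ _))
    (hmem (min_le_right _ _) (le_max_right _ _))

section Sides

variable {f : ℝ × ℝ → X} {c : ℝ × ℝ} {r : ℝ}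

theorem dist_le_of_horizontal_sides (hhor : ∀ y, |y - c.2| = r → LipschitzWith K fun x ↦ f (x, y))
    (hver : ∀ x, |x - c.1| = r → LipschitzWith K fun y ↦ f (x, y)) {p q : ℝ × ℝ}
    (hp : |p.2 - c.2| = r) (hp' : |p.1 - c.1| ≤ r) (hq : |q.2 - c.2| = r) (hq' : |q.1 - c.1| ≤ r) :
    dist (f p) (f q) ≤ 3 * K * dist p q := by
  obtain ⟨x, y⟩ := p
  obtain ⟨x', y'⟩ := q
  rw [Prod.dist_eq]
  rcases eq_or_ne y y' with rfl | hne
  · calc dist (f (x, y)) (f (x', y)) ≤ K * dist x x' := (hhor y hp).dist_le_mul x x'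
      _ ≤ 3 * K * max (dist x x') (dist y y) := by
        gcongr
        · linarith [K.2]
        · exact le_max_left _ _
  -- Opposite sides are at distance `2 * r`; the connecting path goes along the right-hand side.
  have hr : 0 ≤ r := (abs_nonneg _).trans hp'
  have hyy' : dist y y' = 2 * r := by
    rw [Real.dist_eq]
    grind
  have to_right {x : ℝ} (hx : |x - c.1| ≤ r) : dist x (c.1 + r) ≤ 2 * r := by
    rw [Real.dist_eq]
    grind
  calc dist (f (x, y)) (f (x', y'))
      ≤ dist (f (x, y)) (f (c.1 + r, y)) + dist (f (c.1 + r, y)) (f (c.1 + r, y')) +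
          dist (f (c.1 + r, y')) (f (x', y')) := dist_triangle4 _ _ _ _
    _ ≤ K * dist x (c.1 + r) + K * dist y y' + K * dist (c.1 + r) x' := by
      gcongr
      · exact (hhor y hp).dist_le_mul _ _
      · exact (hver _ (by simpa using hr)).dist_le_mul _ _
      · exact (hhor y' hq).dist_le_mul _ _
    _ ≤ K * (2 * r) + K * (2 * r) + K * (2 * r) := by
      rw [dist_comm _ x']
      gcongr
      exacts [to_right hp', hyy'.le, to_right hq']
    _ = 3 * K * dist y y' := by rw [hyy']; ring
    _ ≤ 3 * K * max (dist x x') (dist y y') := by gcongr; exact le_max_right _ _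

theorem dist_le_of_adjacent_sides (hhor : ∀ y, |y - c.2| = r → LipschitzWith K fun x ↦ f (x, y))
    (hver : ∀ x, |x - c.1| = r → LipschitzWith K fun y ↦ f (x, y)) {p q : ℝ × ℝ}
    (hp : |p.2 - c.2| = r) (hq : |q.1 - c.1| = r) :
    dist (f p) (f q) ≤ 3 * K * dist p q := by
  calc dist (f p) (f q) ≤ dist (f (p.1, p.2)) (f (q.1, p.2)) + dist (f (q.1, p.2)) (f (q.1, q.2)) :=
        dist_triangle _ _ _
    _ ≤ K * dist p.1 q.1 + K * dist p.2 q.2 :=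
      add_le_add ((hhor _ hp).dist_le_mul _ _) ((hver _ hq).dist_le_mul _ _)
    _ ≤ K * dist p q + K * dist p q + K * dist p q := by
      rw [Prod.dist_eq]
      refine le_add_of_le_of_nonneg ?_ (by positivity)
      gcongr
      exacts [le_max_left _ _, le_max_right _ _]
    _ = 3 * K * dist p q := by ring

theorem lipschitzOnWith_sphere_of_sides
    (hhor : ∀ y, |y - c.2| = r → LipschitzWith K fun x ↦ f (x, y))
    (hver : ∀ x, |x - c.1| = r → LipschitzWith K fun y ↦ f (x, y)) :
    LipschitzOnWith (3 * K) f (sphere c r) := by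
  have mem_side {p : ℝ × ℝ} (hp : p ∈ sphere c r) :
      |p.2 - c.2| = r ∧ |p.1 - c.1| ≤ r ∨ |p.1 - c.1| = r ∧ |p.2 - c.2| ≤ r := by
    rw [mem_sphere, Prod.dist_eq, Real.dist_eq, Real.dist_eq] at hp
    grind
  refine LipschitzOnWith.of_dist_le_mul fun p hp q hq ↦ ?_
  rcases mem_side hp with ⟨hp, hp'⟩ | ⟨hp, hp'⟩ <;> rcases mem_side hq with ⟨hq, hq'⟩ | ⟨hq, hq'⟩
  · exact dist_le_of_horizontal_sides hhor hver hp hp' hq hq'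
  · exact dist_le_of_adjacent_sides hhor hver hp hq
  · rw [dist_comm, dist_comm p]
    exact dist_le_of_adjacent_sides hhor hver hq hp
  · simpa [Prod.dist_eq, max_comm] using dist_le_of_horizontal_sides (f := f ∘ Prod.swap)
      (c := c.swap) (p := p.swap) (q := q.swap) hver hhor hp hp' hq hq'

end Sides

end Gluing

theorem IsLengthSpace.exists_lipschitzWith_interpolation {X : Type*} [MetricSpace X]
    (hX : IsLengthSpace X) {K : ℝ≥0} {u : ℤ → X} (hu : ∀ k, dist (u k) (u (k + 1)) < K) :
    ∃ p : ℝ → X, LipschitzWith K p ∧ ∀ k : ℤ, p k = u k := by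
  choose q hq hq0 hq1 using fun k ↦ hX (u k) (u (k + 1)) K (hu k)
  have eq_on_interval (k : ℤ) : EqOn (fun t ↦ q ⌊t⌋ (t - ⌊t⌋)) (fun t ↦ q k (t - k))
      (Icc k (k + 1)) := by
    rintro t ⟨hkt, htk⟩
    rcases htk.lt_or_eq with htk | rfl
    · simp only [Int.floor_eq_iff.2 ⟨hkt, htk⟩]
    · have : ⌊(k : ℝ) + 1⌋ = k + 1 := by simp
      simp [this, hq0, hq1]
  refine ⟨fun t ↦ q ⌊t⌋ (t - ⌊t⌋), lipschitzWith_of_forall_Icc_int fun k ↦ ?_, fun k ↦ ?_⟩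
  · intro s hs t ht
    rw [eq_on_interval k hs, eq_on_interval k ht]
    simpa using hq k (s - k) (t - k)
  · simp [hq0]

/-- Every `L`-Lipschitz loop in `X`, parametrized by the boundary of the square `[-1, 1]²`, has a
`C`-Lipschitz filling (extended to the whole plane, which avoids subtypes). -/
def SquareLoopsFill (X : Type*) [MetricSpace X] (L C : ℝ≥0) : Prop :=
  ∀ g : ℝ × ℝ → X, LipschitzOnWith L g (sphere 0 1) →
    ∃ f : ℝ × ℝ → X, LipschitzWith C f ∧ EqOn f g (sphere 0 1)

section CoarseFilling

variable {X : Type*} [MetricSpace X]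

theorem SquareLoopsFill.rescale {L C r : ℝ≥0} (hr : 0 < r)
    (h : SquareLoopsFill X (r * L) (r * C)) (c : ℝ × ℝ) {g : ℝ × ℝ → X}
    (hg : LipschitzOnWith L g (sphere c r)) :
    ∃ f : ℝ × ℝ → X, LipschitzWith C f ∧ EqOn f g (sphere c r) := by
  have hr' : (r : ℝ) ≠ 0 := NNReal.coe_ne_zero.2 hr.ne'
  have hg' : LipschitzOnWith (L * r) (g ∘ fun p ↦ c + (r : ℝ) • p) (sphere 0 1) := by
    refine hg.comp (LipschitzWith.of_dist_le_mul fun p q ↦ ?_).lipschitzOnWith fun p hp ↦ ?_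
    · rw [dist_add_left, dist_smul₀, Real.norm_eq_abs, NNReal.abs_eq]
    · rw [mem_sphere_zero_iff_norm] at hp
      simp [mem_sphere_iff_norm, norm_smul, hp]
  obtain ⟨f, hf, hfg⟩ := h _ (by rwa [mul_comm])
  refine ⟨f ∘ fun p ↦ (r : ℝ)⁻¹ • (p - c), ?_, fun p hp ↦ ?_⟩
  · have hscale : LipschitzWith r⁻¹ fun p : ℝ × ℝ ↦ (r : ℝ)⁻¹ • (p - c) :=
      LipschitzWith.of_dist_le_mul fun p q ↦ by
        rw [dist_smul₀, dist_sub_right, norm_inv, Real.norm_eq_abs, NNReal.abs_eq,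
          NNReal.coe_inv]
    convert hf.comp hscale using 1
    rw [mul_right_comm, mul_inv_cancel₀ hr.ne', one_mul]
  · rw [mem_sphere_iff_norm] at hp
    have hmem : (r : ℝ)⁻¹ • (p - c) ∈ sphere (0 : ℝ × ℝ) 1 := by
      rw [mem_sphere_zero_iff_norm, norm_smul, hp, norm_inv, Real.norm_eq_abs, NNReal.abs_eq,
        inv_mul_cancel₀ hr']
    simpa [smul_smul, hr'] using hfg hmem

theorem SquareLoopsFill.mono {L L' C C' : ℝ≥0} (h : SquareLoopsFill X L C) (hL : L' ≤ L)
    (hC : C ≤ C') : SquareLoopsFill X L' C' := fun g hg ↦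
  (h g (hg.weaken hL)).imp fun _ hf ↦ ⟨hf.1.weaken hC, hf.2⟩

theorem squareLoopsFill_of_forall_sphere {L C r : ℝ≥0} (hr : 0 < r)
    (h : ∀ g : ℝ × ℝ → X, LipschitzOnWith L g (sphere 0 r) →
      ∃ f : ℝ × ℝ → X, LipschitzWith C f ∧ EqOn f g (sphere 0 r)) :
    SquareLoopsFill X (r * L) (r * C) := by
  have hr' : (r : ℝ) ≠ 0 := NNReal.coe_ne_zero.2 hr.ne'
  have lipschitzWith_smul (a : ℝ≥0) : LipschitzWith a fun p : ℝ × ℝ ↦ (a : ℝ) • p := by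
    simpa using lipschitzWith_smul (β := ℝ × ℝ) (a : ℝ)
  have smul_mem {a s : ℝ≥0} {p : ℝ × ℝ} (hp : p ∈ sphere 0 (s : ℝ)) :
      (a : ℝ) • p ∈ sphere 0 (a * s : ℝ) := by
    rw [mem_sphere_zero_iff_norm] at hp ⊢
    rw [norm_smul, hp, Real.norm_eq_abs, NNReal.abs_eq]
  intro g hg
  obtain ⟨f, hf, hfg⟩ := h (g ∘ fun p ↦ ((r⁻¹ : ℝ≥0) : ℝ) • p) <| by
    convert hg.comp (lipschitzWith_smul r⁻¹).lipschitzOnWith fun p hp ↦ ?_ using 1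
    · rw [mul_right_comm, mul_inv_cancel₀ hr.ne', one_mul]
    · simpa [hr'] using smul_mem (a := r⁻¹) hp
  refine ⟨f ∘ fun p ↦ (r : ℝ) • p, ?_, fun p hp ↦ ?_⟩
  · rw [mul_comm]
    exact hf.comp (lipschitzWith_smul r)
  · have hmem : (r : ℝ) • p ∈ sphere 0 (r : ℝ) := by simpa using smul_mem (a := r) (s := 1) hp
    simp [hfg hmem, smul_smul, hr']

section Grid

variable {hor ver : ℤ → ℝ → X} {K C : ℝ≥0}

theorem exists_extension_of_grid_lines {X : Type*} {hor ver : ℤ → ℝ → X}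
    (hcross : ∀ i j : ℤ, hor j i = ver i j) :
    ∃ e : ℝ × ℝ → X, (∀ (j : ℤ) (x : ℝ), e (x, j) = hor j x) ∧
      ∀ (i : ℤ) (y : ℝ), e (i, y) = ver i y := by
  classical
  refine ⟨fun p ↦ if p.2 = ⌊p.2⌋ then hor ⌊p.2⌋ p.1 else ver ⌊p.1⌋ p.2, fun j x ↦ by simp,
    fun i y ↦ ?_⟩
  simp only [Int.floor_intCast, ite_eq_right_iff]
  intro hy
  rw [hcross, ← hy]

/-- The cell of the unit grid with lower left corner `(i, j)`; for the supremum norm it is the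
closed ball with center `(i + 1 / 2, j + 1 / 2)` and radius `1 / 2`. -/
def gridCell (i j : ℤ) : Set (ℝ × ℝ) := Icc (i : ℝ) (i + 1) ×ˢ Icc (j : ℝ) (j + 1)

theorem mem_sphere_of_mem_gridCell {i j : ℤ} {p : ℝ × ℝ} (hp : p ∈ gridCell i j)
    (hint : p.1 ∈ range ((↑) : ℤ → ℝ) ∨ p.2 ∈ range ((↑) : ℤ → ℝ)) :
    p ∈ sphere ((i + 1 / 2, j + 1 / 2) : ℝ × ℝ) (1 / 2) := by
  obtain ⟨⟨h1, h1'⟩, h2, h2'⟩ := hp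
  have abs_eq {k : ℤ} {x : ℝ} (hx : x ∈ range ((↑) : ℤ → ℝ)) (h : (k : ℝ) ≤ x)
      (h' : x ≤ k + 1) : |x - (k + 1 / 2)| = 1 / 2 := by
    obtain ⟨l, rfl⟩ := hx
    norm_cast at h h'
    obtain rfl | rfl : l = k ∨ l = k + 1 := by lia
    · norm_num
    · push_cast
      norm_num
  rw [mem_sphere, Prod.dist_eq, Real.dist_eq, Real.dist_eq]
  rcases hint with hint | hint
  · rw [abs_eq hint h1 h1']
    exact max_eq_left (abs_le.2 ⟨by linarith, by linarith⟩)
  · rw [abs_eq hint h2 h2']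
    exact max_eq_right (abs_le.2 ⟨by linarith, by linarith⟩)

theorem exists_lipschitzWith_of_fill_gridCells {e : ℝ × ℝ → X} {f : ℤ → ℤ → ℝ × ℝ → X}
    (hf : ∀ i j, LipschitzWith C (f i j))
    (hfe : ∀ i j : ℤ, EqOn (f i j) e (sphere ((i + 1 / 2, j + 1 / 2) : ℝ × ℝ) (1 / 2))) :
    ∃ F : ℝ × ℝ → X, LipschitzWith (C + C) F ∧
      ∀ p : ℝ × ℝ, p.1 ∈ range ((↑) : ℤ → ℝ) ∨ p.2 ∈ range ((↑) : ℤ → ℝ) → F p = e p := by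
  set F : ℝ × ℝ → X := fun p ↦ f ⌊p.1⌋ ⌊p.2⌋ p
  have mem_gridCell_floor (p : ℝ × ℝ) : p ∈ gridCell ⌊p.1⌋ ⌊p.2⌋ :=
    ⟨⟨Int.floor_le _, (Int.lt_floor_add_one _).le⟩, Int.floor_le _, (Int.lt_floor_add_one _).le⟩
  have eq_e (p : ℝ × ℝ) (hp : p.1 ∈ range ((↑) : ℤ → ℝ) ∨ p.2 ∈ range ((↑) : ℤ → ℝ)) :
      F p = e p := hfe _ _ (mem_sphere_of_mem_gridCell (mem_gridCell_floor p) hp)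
  have eqOn_cell (i j : ℤ) : EqOn F (f i j) (gridCell i j) := by
    intro p hp
    by_cases hint : p.1 ∈ range ((↑) : ℤ → ℝ) ∨ p.2 ∈ range ((↑) : ℤ → ℝ)
    · rw [eq_e p hint, hfe i j (mem_sphere_of_mem_gridCell hp hint)]
    have floor_eq {k : ℤ} {x : ℝ} (hx : x ∈ Icc (k : ℝ) (k + 1)) (h : x ∉ range ((↑) : ℤ → ℝ)) :
        ⌊x⌋ = k :=
      Int.floor_eq_iff.2 ⟨hx.1, hx.2.lt_of_ne fun h' ↦ h ⟨k + 1, by simp [h']⟩⟩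
    rw [not_or] at hint
    simp only [F, floor_eq hp.1 hint.1, floor_eq hp.2 hint.2]
  refine ⟨F, LipschitzWith.uncurry (f := fun x y ↦ F (x, y)) (fun y ↦ ?_) fun x ↦ ?_, eq_e⟩
  · refine lipschitzWith_of_forall_Icc_int fun i ↦ ?_
    have hmem {x : ℝ} (hx : x ∈ Icc (i : ℝ) (i + 1)) := mk_mem_prod hx (mem_gridCell_floor (0, y)).2
    refine LipschitzOnWith.of_dist_le_mul fun x hx x' hx' ↦ ?_
    rw [eqOn_cell _ _ (hmem hx), eqOn_cell _ _ (hmem hx')]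
    simpa [Prod.dist_eq] using (hf i ⌊y⌋).dist_le_mul (x, y) (x', y)
  · refine lipschitzWith_of_forall_Icc_int fun j ↦ ?_
    have hmem {y : ℝ} (hy : y ∈ Icc (j : ℝ) (j + 1)) := mk_mem_prod (mem_gridCell_floor (x, 0)).1 hy
    refine LipschitzOnWith.of_dist_le_mul fun y hy y' hy' ↦ ?_
    rw [eqOn_cell _ _ (hmem hy), eqOn_cell _ _ (hmem hy')]
    simpa [Prod.dist_eq] using (hf ⌊x⌋ j).dist_le_mul (x, y) (x, y')

theorem exists_lipschitzWith_of_grid_lines (h : SquareLoopsFill X (1 / 2 * (3 * K)) (1 / 2 * C))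
    (hhor : ∀ j, LipschitzWith K (hor j)) (hver : ∀ i, LipschitzWith K (ver i))
    (hcross : ∀ i j : ℤ, hor j i = ver i j) :
    ∃ F : ℝ × ℝ → X, LipschitzWith (C + C) F ∧ (∀ (j : ℤ) (x : ℝ), F (x, j) = hor j x) ∧
      ∀ (i : ℤ) (y : ℝ), F (i, y) = ver i y := by
  obtain ⟨e, he_hor, he_ver⟩ := exists_extension_of_grid_lines hcross
  have int_of_abs {k : ℤ} {x : ℝ} (hx : |x - (k + 1 / 2)| = 1 / 2) : ∃ l : ℤ, x = l := by
    rcases (abs_eq (by norm_num)).1 hx with hx | hx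
    · exact ⟨k + 1, by push_cast; linarith⟩
    · exact ⟨k, by linarith⟩
  have he (i j : ℤ) :
      LipschitzOnWith (3 * K) e (sphere ((i + 1 / 2, j + 1 / 2) : ℝ × ℝ) (1 / 2)) := by
    refine lipschitzOnWith_sphere_of_sides (fun y hy ↦ ?_) fun x hx ↦ ?_
    · obtain ⟨l, rfl⟩ := int_of_abs hy
      simpa only [he_hor] using hhor l
    · obtain ⟨l, rfl⟩ := int_of_abs hx
      simpa only [he_ver] using hver l
  choose f hf hfe using fun i j : ℤ ↦ h.rescale (by norm_num) (i + 1 / 2, j + 1 / 2)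
    (g := e) (by simpa using he i j)
  obtain ⟨F, hF, hFe⟩ := exists_lipschitzWith_of_fill_gridCells hf (by simpa using hfe)
  exact ⟨F, hF, fun j x ↦ by rw [hFe _ (.inr ⟨j, rfl⟩), he_hor],
    fun i y ↦ by rw [hFe _ (.inl ⟨i, rfl⟩), he_ver]⟩

end Grid

section Coarse

variable {K C : ℝ≥0} {N : ℕ}

theorem IsLengthSpace.exists_grid_line (hX : IsLengthSpace X) (hK : 0 < K) {v : ℝ × ℝ → X}
    (hv : ∀ p q, dist p q ≤ 1 → dist (v p) (v q) ≤ 2 * K)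
    (hout : LipschitzOnWith K v {p | N ≤ ‖p‖}) {ℓ : ℝ → ℝ × ℝ} (hℓ : LipschitzWith 1 ℓ) :
    ∃ σ : ℝ → X, LipschitzWith (3 * K) σ ∧ (∀ k : ℤ, σ k = v (ℓ k)) ∧
      ((∀ t, N ≤ ‖ℓ t‖) → σ = v ∘ ℓ) := by
  by_cases h : ∀ t, N ≤ ‖ℓ t‖
  · refine ⟨v ∘ ℓ, ?_, fun _ ↦ rfl, fun _ ↦ rfl⟩
    have hvℓ : LipschitzOnWith (K * 1) (v ∘ ℓ) univ :=
      hout.comp hℓ.lipschitzOnWith fun t _ ↦ h t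
    refine (lipschitzOnWith_univ.1 hvℓ).weaken ?_
    rw [mul_one]
    exact le_mul_of_one_le_left' (by norm_num)
  · have hstep (k : ℤ) : dist (v (ℓ k)) (v (ℓ (k + 1 : ℤ))) < (3 * K : ℝ≥0) := by
      refine (hv _ _ ((hℓ.dist_le_mul _ _).trans ?_)).trans_lt ?_
      · simp
      · push_cast
        exact mul_lt_mul_of_pos_right (by norm_num) (NNReal.coe_pos.2 hK)
    obtain ⟨σ, hσ, hσv⟩ := hX.exists_lipschitzWith_interpolation hstep
    exact ⟨σ, hσ, hσv, fun h' ↦ absurd h' h⟩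

theorem exists_intCast_eq_of_abs_eq_natCast {N : ℕ} {x : ℝ} (hx : |x| = N) : ∃ k : ℤ, x = k := by
  rcases (abs_eq N.cast_nonneg).1 hx with rfl | rfl
  exacts [⟨N, by simp⟩, ⟨-N, by simp⟩]

theorem SquareLoopsFill.exists_lipschitzWith_eqOn_of_coarse
    (h : SquareLoopsFill X (1 / 2 * (3 * (3 * K))) (1 / 2 * C)) (hX : IsLengthSpace X)
    (hK : 0 < K) {v : ℝ × ℝ → X} (hv : ∀ p q, dist p q ≤ 1 → dist (v p) (v q) ≤ 2 * K)
    (hout : LipschitzOnWith K v {p | N ≤ ‖p‖}) :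
    ∃ F : ℝ × ℝ → X, LipschitzWith (C + C) F ∧ EqOn F v (sphere 0 N) := by
  choose hor hhor hhorv hor_out using fun j : ℤ ↦
    hX.exists_grid_line hK hv hout (LipschitzWith.prodMk_right (j : ℝ))
  choose ver hver hverv ver_out using fun i : ℤ ↦
    hX.exists_grid_line hK hv hout (LipschitzWith.prodMk_left (i : ℝ))
  obtain ⟨F, hF, hF_hor, hF_ver⟩ := exists_lipschitzWith_of_grid_lines h hhor hver
    fun i j ↦ by rw [hhorv, hverv]
  refine ⟨F, hF, fun ⟨x, y⟩ hp ↦ ?_⟩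
  rw [mem_sphere_zero_iff_norm, Prod.norm_def, Real.norm_eq_abs, Real.norm_eq_abs] at hp
  rcases max_choice |x| |y| with hmax | hmax
  · obtain ⟨i, rfl⟩ := exists_intCast_eq_of_abs_eq_natCast (hmax.symm.trans hp)
    rw [hF_ver, ver_out i fun t ↦ (hmax.symm.trans hp).symm.trans_le (norm_fst_le ((i : ℝ), t))]
    rfl
  · obtain ⟨j, rfl⟩ := exists_intCast_eq_of_abs_eq_natCast (hmax.symm.trans hp)
    rw [hF_hor, hor_out j fun t ↦ (hmax.symm.trans hp).symm.trans_le (norm_snd_le (t, (j : ℝ)))]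
    rfl

theorem SquareLoopsFill.exists_filling_of_coarse_filling
    (h : SquareLoopsFill X (1 / 2 * (3 * (3 * K))) (1 / 2 * C)) (hX : IsLengthSpace X)
    (hK : 0 < K) {g w : ℝ × ℝ → X} (hg : LipschitzOnWith K g (sphere 0 N))
    (hw : ∀ p q, dist p q ≤ 1 → dist (w p) (w q) ≤ K)
    (hwg : ∀ p ∈ sphere 0 (N : ℝ), dist (w p) (g p) ≤ K) :
    ∃ F : ℝ × ℝ → X, LipschitzWith (C + C) F ∧ EqOn F g (sphere 0 N) := by
  classical
  set v : ℝ × ℝ → X := fun p ↦ if ‖p‖ < N then w p else g (clampSquare N p)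
  have v_in {p : ℝ × ℝ} (hp : ‖p‖ < N) : v p = w p := if_pos hp
  have v_out {p : ℝ × ℝ} (hp : N ≤ ‖p‖) : v p = g (clampSquare N p) := if_neg hp.not_gt
  have hclamp {p : ℝ × ℝ} (hp : N ≤ ‖p‖) : clampSquare N p ∈ sphere 0 (N : ℝ) :=
    clampSquare.mem_sphere N.cast_nonneg hp
  have hclamp_dist (p q : ℝ × ℝ) : dist (clampSquare N p) (clampSquare N q) ≤ dist p q := by
    simpa using (clampSquare.lipschitzWith N).dist_le_mul p q
  have hout : LipschitzOnWith K v {p | N ≤ ‖p‖} := by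
    refine LipschitzOnWith.of_dist_le_mul fun p hp q hq ↦ ?_
    rw [v_out hp, v_out hq]
    exact (hg.dist_le_mul _ (hclamp hp) _ (hclamp hq)).trans (by gcongr; exact hclamp_dist p q)
  have in_out {p q : ℝ × ℝ} (hp : ‖p‖ < N) (hq : N ≤ ‖q‖) (hpq : dist p q ≤ 1) :
      dist (v p) (v q) ≤ 2 * K := by
    have hpq' := hclamp_dist p q
    rw [clampSquare.eq_self hp.le] at hpq'
    rw [v_in hp, v_out hq]
    linarith [dist_triangle (w p) (w (clampSquare N q)) (g (clampSquare N q)),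
      hw _ _ (hpq'.trans hpq), hwg _ (hclamp hq)]
  have hv (p q : ℝ × ℝ) (hpq : dist p q ≤ 1) : dist (v p) (v q) ≤ 2 * K := by
    rcases lt_or_ge ‖p‖ N with hp | hp <;> rcases lt_or_ge ‖q‖ N with hq | hq
    · rw [v_in hp, v_in hq]
      linarith [hw p q hpq, K.2]
    · exact in_out hp hq hpq
    · rw [dist_comm] at hpq ⊢
      exact in_out hq hp hpq
    · refine (hout.dist_le_mul p hp q hq).trans ?_
      nlinarith [K.2]
  obtain ⟨F, hF, hFv⟩ := h.exists_lipschitzWith_eqOn_of_coarse hX hK hv hout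
  refine ⟨F, hF, fun p hp ↦ ?_⟩
  have hp' := mem_sphere_zero_iff_norm.1 hp
  rw [hFv hp, v_out hp'.ge, clampSquare.eq_self hp'.le]

end Coarse

end CoarseFilling

section LocalFilling

theorem IsHomogeneousMetricSpace.squareLoopsFill {X : Type*} [MetricSpace X]
    (hX : IsHomogeneousMetricSpace X) {L C : ℝ≥0} (x₀ : X)
    (h : ∀ g : ℝ × ℝ → X, LipschitzOnWith L g (sphere 0 1) → g (1, 0) = x₀ →
      ∃ f : ℝ × ℝ → X, LipschitzWith C f ∧ EqOn f g (sphere 0 1)) :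
    SquareLoopsFill X L C := by
  intro g hg
  obtain ⟨e, he⟩ := hX (g (1, 0)) x₀
  obtain ⟨f, hf, hfg⟩ := h (e ∘ g) (by simpa using e.isometry.lipschitz.comp_lipschitzOnWith hg) he
  refine ⟨e.symm ∘ f, by simpa using e.symm.isometry.lipschitz.comp hf, fun p hp ↦ ?_⟩
  simp [hfg hp]

variable {E : Type*} [NormedAddCommGroup E] [NormedSpace ℝ E] [FiniteDimensional ℝ E]

theorem eventually_fill_of_bilipschitz_chart {X : Type*} [MetricSpace X] {φ : X → E} {ψ : E → X}
    {x₀ : X} {C₁ C₂ : ℝ≥0} {r₁ r₂ : ℝ} (hr₁ : 0 < r₁) (hr₂ : 0 < r₂)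
    (hφ : LipschitzOnWith C₁ φ (ball x₀ r₁)) (hψ : LipschitzOnWith C₂ ψ (ball (φ x₀) r₂))
    (hψφ : LeftInvOn ψ φ (ball x₀ r₁)) :
    ∃ C : ℝ≥0, ∀ᶠ L in 𝓝 (0 : ℝ≥0), ∀ g : ℝ × ℝ → X, LipschitzOnWith L g (sphere 0 1) →
      g (1, 0) = x₀ → ∃ f : ℝ × ℝ → X, LipschitzWith (C * L) f ∧ EqOn f g (sphere 0 1) := by
  set A := lipschitzExtensionConstant E
  have small {D : ℝ≥0} {r : ℝ} (hr : 0 < r) : ∀ᶠ L in 𝓝 (0 : ℝ≥0), (D * L : ℝ≥0) * 2 < r := by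
    have : Continuous fun L : ℝ≥0 ↦ ((D * L : ℝ≥0) * 2 : ℝ) := by fun_prop
    exact this.tendsto' 0 0 (by simp) |>.eventually_lt_const hr
  refine ⟨C₂ * (A * C₁), ?_⟩
  filter_upwards [small (D := 1) hr₁, small (D := A * C₁) hr₂] with L hL₁ hL₂ g hg hg0
  have hbase : ((1, 0) : ℝ × ℝ) ∈ sphere 0 1 := by simp [Prod.norm_def]
  have dist_base {p : ℝ × ℝ} (hp : ‖p‖ ≤ 1) : dist p (1, 0) ≤ 2 := by
    have h1 := mem_sphere_zero_iff_norm.1 hbase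
    linarith [dist_le_norm_add_norm p (1, 0)]
  have hgball : MapsTo g (sphere 0 1) (ball x₀ r₁) := fun p hp ↦ by
    rw [← hg0, mem_ball]
    rw [one_mul] at hL₁
    refine (hg.dist_le_mul p hp _ hbase).trans_lt (lt_of_le_of_lt ?_ hL₁)
    gcongr
    exact dist_base (mem_sphere_zero_iff_norm.1 hp).le
  obtain ⟨G, hG, hGeq⟩ := (hφ.comp hg hgball).extend_finite_dimension
  rw [← mul_assoc] at hG
  have hGball : MapsTo (G ∘ clampSquare 1) univ (ball (φ x₀) r₂) := fun p _ ↦ by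
    have hG0 : G (1, 0) = φ x₀ := by rw [← hGeq hbase, Function.comp_apply, hg0]
    rw [← hG0, mem_ball]
    refine (hG.dist_le_mul _ _).trans_lt (lt_of_le_of_lt ?_ hL₂)
    gcongr
    exact dist_base (by simp [clampSquare.norm_eq])
  refine ⟨ψ ∘ G ∘ clampSquare 1, ?_, fun p hp ↦ ?_⟩
  · rw [← lipschitzOnWith_univ]
    convert hψ.comp (hG.comp (clampSquare.lipschitzWith 1)).lipschitzOnWith hGball using 1
    ring
  · simp only [Function.comp_apply, clampSquare.eq_self (mem_sphere_zero_iff_norm.1 hp).le,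
      ← hGeq hp, hψφ (hgball hp)]

theorem IsHomogeneousMetricSpace.exists_squareLoopsFill_small {M : Type*} [MetricSpace M]
    {H : Type*} [TopologicalSpace H] (I : ModelWithCorners ℝ E H) [I.Boundaryless]
    [ChartedSpace H M] [Bundle.RiemannianBundle (fun x : M ↦ TangentSpace I x)]
    [IsManifold I 1 M] [IsContinuousRiemannianBundle E (fun x : M ↦ TangentSpace I x)]
    [IsRiemannianManifold I M] [Nonempty M] (hM : IsHomogeneousMetricSpace M) :
    ∃ ρ > 0, ∃ C : ℝ≥0, ∀ L ≤ ρ, SquareLoopsFill M L (C * L) := by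
  obtain ⟨x₀⟩ := ‹Nonempty M›
  obtain ⟨C₁, r₁, hr₁, hsource, hchart⟩ := exists_lipschitzOnWith_extChartAt I x₀
  obtain ⟨C₂, r₂, hr₂, -, hsymm⟩ := exists_lipschitzOnWith_extChartAt_symm I x₀
  obtain ⟨C, hC⟩ := eventually_fill_of_bilipschitz_chart hr₁ hr₂ hchart hsymm
    fun x hx ↦ (extChartAt I x₀).left_inv (hsource hx)
  obtain ⟨ρ, hρ, hsmall⟩ := NNReal.nhds_zero_basis.eventually_iff.1 hC
  exact ⟨ρ / 2, half_pos hρ, C, fun L hL ↦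
    hM.squareLoopsFill x₀ (hsmall (hL.trans_lt (NNReal.half_lt_self hρ.ne')))⟩

end LocalFilling

section Proper

variable {X : Type*} [MetricSpace X]

theorem IsLengthSpace.exists_dist_le_dist_le (hX : IsLengthSpace X) {x y : X} {a b : ℝ}
    (ha : 0 ≤ a) (hb : 0 ≤ b) (h : dist x y < a + b) : ∃ z, dist z x ≤ a ∧ dist z y ≤ b := by
  lift a to ℝ≥0 using ha
  lift b to ℝ≥0 using hb
  have hab : (a + b : ℝ) ≠ 0 := (dist_nonneg.trans_lt h).ne'
  obtain ⟨p, hp, rfl, rfl⟩ := hX x y (a + b) (by simpa using h)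
  refine ⟨p (a / (a + b)), (hp.dist_le_mul _ _).trans_eq ?_, (hp.dist_le_mul _ _).trans_eq ?_⟩
  · rw [Real.dist_eq, sub_zero, abs_of_nonneg (by positivity), NNReal.coe_add,
      mul_div_cancel₀ _ hab]
  · have : (a / (a + b) - 1 : ℝ) = -(b / (a + b)) := by field_simp; ring
    rw [Real.dist_eq, this, abs_neg, abs_of_nonneg (by positivity), NNReal.coe_add,
      mul_div_cancel₀ _ hab]

theorem IsLengthSpace.isCompact_closedBall_add (hX : IsLengthSpace X) {r R : ℝ} (hr : 0 < r)
    (hR : 0 ≤ R) {x : X} (hcpt : ∀ y : X, IsCompact (closedBall y r))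
    (hx : IsCompact (closedBall x R)) : IsCompact (closedBall x (R + r / 2)) := by
  obtain ⟨t, -, ht, hcover⟩ := hx.finite_cover_balls (e := r / 4) (by positivity)
  refine (ht.isCompact_biUnion fun z _ ↦ hcpt z).of_isClosed_subset isClosed_closedBall
    fun y hy ↦ ?_
  rw [mem_closedBall, dist_comm] at hy
  obtain ⟨z, hzx, hzy⟩ := hX.exists_dist_le_dist_le hR (b := 3 * r / 4) (by positivity)
    (x := x) (y := y) (by linarith)
  obtain ⟨c, hct, hzc⟩ := mem_iUnion₂.1 (hcover (mem_closedBall.2 hzx))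
  refine mem_iUnion₂.2 ⟨c, hct, ?_⟩
  rw [mem_ball] at hzc
  rw [mem_closedBall]
  linarith [dist_triangle_left y c z]

theorem IsHomogeneousMetricSpace.properSpace [LocallyCompactSpace X]
    (hX : IsHomogeneousMetricSpace X) (hlen : IsLengthSpace X) : ProperSpace X := by
  rcases isEmpty_or_nonempty X with hempty | ⟨⟨x₀⟩⟩
  · exact ⟨isEmptyElim⟩
  obtain ⟨r, hr, hcpt₀⟩ := Metric.exists_isCompact_closedBall x₀
  have hcpt (x : X) : IsCompact (closedBall x r) := by
    obtain ⟨e, rfl⟩ := hX x₀ x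
    rw [← e.image_closedBall]
    exact hcpt₀.image e.continuous
  have hseq (n : ℕ) : IsCompact (closedBall x₀ (n * (r / 2))) := by
    induction n with
    | zero => simp
    | succ n ih =>
      rw [Nat.cast_succ, add_one_mul]
      exact hlen.isCompact_closedBall_add hr (by positivity) hcpt ih
  exact ProperSpace.of_seq_closedBall
    (tendsto_natCast_atTop_atTop.atTop_mul_const (half_pos hr)) (.of_forall hseq)

end Proper

section ContinuousFilling

open unitInterval

theorem continuous_pathHomotopy_comp {X Z : Type*} [TopologicalSpace X] [TopologicalSpace Z]
    {x y : X} {p q : Path x y} (H : p.Homotopy q) {φ τ : Z → I} (hτ : Continuous τ)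
    (hφ : ∀ z, τ z ≠ 0 → τ z ≠ 1 → ContinuousAt φ z) : Continuous fun z ↦ H (φ z, τ z) := by
  have tendsto_of_const {t : I} {a : X} (ht : ∀ s, H (s, t) = a) {z : Z} (hz : τ z = t) :
      ContinuousAt (fun z ↦ H (φ z, τ z)) z := by
    intro U hU
    simp only [hz, ht] at hU
    have htube : ∀ᶠ t' in 𝓝 t, ∀ s ∈ univ, H (s, t') ∈ U :=
      isCompact_univ.eventually_forall_of_forall_eventually fun s _ ↦
        (H.continuous.comp continuous_swap).continuousAt.eventually_mem (by simpa [ht] using hU)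
    rw [mem_map]
    filter_upwards [hτ.continuousAt.eventually (hz ▸ htube)] with z' hz' using hz' _ (mem_univ _)
  refine continuous_iff_continuousAt.2 fun z ↦ ?_
  by_cases h0 : τ z = 0
  · exact tendsto_of_const (fun s ↦ H.source s) h0
  by_cases h1 : τ z = 1
  · exact tendsto_of_const (fun s ↦ H.target s) h1
  exact H.continuous.continuousAt.comp ((hφ z h0 h1).prodMk hτ.continuousAt)

theorem two_mul_norm_prod_eq (p : ℝ × ℝ) : 2 * ‖p‖ = |p.1 + p.2| + |p.1 - p.2| := by
  rw [Prod.norm_def, Real.norm_eq_abs, Real.norm_eq_abs]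
  grind

/-- The point with coordinate sum `c` and coordinate difference `ε * (2 - |c|)`. For `|c| ≤ 2`,
the values `ε = 1` and `ε = -1` give the two points where the antidiagonal of coordinate sum `c`
leaves the square `[-1, 1]²`. -/
noncomputable def antidiagonalPoint (ε c : ℝ) : ℝ × ℝ :=
  ((c + ε * (2 - |c|)) / 2, (c - ε * (2 - |c|)) / 2)

theorem antidiagonalPoint_fst_add_snd (ε c : ℝ) :
    (antidiagonalPoint ε c).1 + (antidiagonalPoint ε c).2 = c := by
  simp only [antidiagonalPoint]
  ring

theorem antidiagonalPoint_fst_sub_snd (ε c : ℝ) :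
    (antidiagonalPoint ε c).1 - (antidiagonalPoint ε c).2 = ε * (2 - |c|) := by
  simp only [antidiagonalPoint]
  ring

theorem antidiagonalPoint_mem_sphere {ε c : ℝ} (hε : |ε| = 1) (hc : |c| ≤ 2) :
    antidiagonalPoint ε c ∈ sphere 0 1 := by
  have h := two_mul_norm_prod_eq (antidiagonalPoint ε c)
  rw [antidiagonalPoint_fst_add_snd, antidiagonalPoint_fst_sub_snd, abs_mul, hε,
    abs_of_nonneg (sub_nonneg.2 hc)] at h
  rw [mem_sphere_zero_iff_norm]
  linarith

theorem exists_eq_antidiagonalPoint_of_mem_sphere {p : ℝ × ℝ} (hp : p ∈ sphere 0 1) :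
    ∃ t : I, p = antidiagonalPoint 1 (4 * t - 2) ∨ p = antidiagonalPoint (-1) (4 * t - 2) := by
  have hnorm := two_mul_norm_prod_eq p
  rw [mem_sphere_zero_iff_norm.1 hp, mul_one] at hnorm
  have hc := abs_le.1 (show |p.1 + p.2| ≤ 2 by linarith [abs_nonneg (p.1 - p.2)])
  refine ⟨⟨(p.1 + p.2 + 2) / 4, by linarith [hc.1], by linarith [hc.2]⟩, ?_⟩
  have hsum : 4 * ((p.1 + p.2 + 2) / 4) - 2 = p.1 + p.2 := by ring
  rw [hsum]
  rcases abs_choice (p.1 - p.2) with hd | hd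
  · left; ext <;> simp only [antidiagonalPoint] <;> linarith
  · right; ext <;> simp only [antidiagonalPoint] <;> linarith

variable {X : Type*} [TopologicalSpace X]

-- The antidiagonal of coordinate sum `4 * t - 2` carries the track `s ↦ H (s, t)`.
theorem exists_continuous_antidiagonalPoint_eq {x y : X} {p q : Path x y} (H : p.Homotopy q) :
    ∃ f : ℝ × ℝ → X, Continuous f ∧ ∀ t : I, f (antidiagonalPoint 1 (4 * t - 2)) = p t ∧
      f (antidiagonalPoint (-1) (4 * t - 2)) = q t := by
  let slope (z : ℝ × ℝ) : ℝ := (z.1 - z.2) / (2 - |z.1 + z.2|)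
  let τ (z : ℝ × ℝ) : I := projIcc 0 1 zero_le_one ((z.1 + z.2 + 2) / 4)
  refine ⟨fun z ↦ H (projIcc 0 1 zero_le_one ((1 - slope z) / 2), τ z),
    continuous_pathHomotopy_comp H (by fun_prop) fun z h0 h1 ↦ ?_, fun t ↦ ?_⟩
  · have hz : 2 - |z.1 + z.2| ≠ 0 := fun h ↦ by
      rcases (abs_eq zero_le_two).1 (sub_eq_zero.1 h).symm with hc | hc
      · exact h1 (projIcc_of_right_le _ (by linarith))
      · exact h0 (projIcc_of_le_left _ (by linarith))
    have : ContinuousAt slope z := by fun_prop (disch := exact hz)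
    fun_prop
  have hτ (ε : ℝ) : τ (antidiagonalPoint ε (4 * t - 2)) = t := by
    have : (4 * (t : ℝ) - 2 + 2) / 4 = t := by ring
    simp only [τ, antidiagonalPoint_fst_add_snd, this, projIcc_val]
  simp only [hτ]
  rcases eq_or_ne (2 - |4 * (t : ℝ) - 2|) 0 with hw | hw
  · rcases (abs_eq zero_le_two).1 (sub_eq_zero.1 hw).symm with hc | hc
    · obtain rfl : t = 1 := Subtype.ext (by rw [Icc.coe_one]; linarith)
      simp
    · obtain rfl : t = 0 := Subtype.ext (by rw [Icc.coe_zero]; linarith)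
      simp
  have hslope (ε : ℝ) : slope (antidiagonalPoint ε (4 * t - 2)) = ε := by
    simp only [slope, antidiagonalPoint_fst_sub_snd, antidiagonalPoint_fst_add_snd,
      mul_div_cancel_right₀ _ hw]
  constructor
  · simp [hslope]
  · norm_num [hslope]

theorem exists_continuous_eqOn_sphere [SimplyConnectedSpace X] {g : ℝ × ℝ → X}
    (hg : ContinuousOn g (sphere 0 1)) :
    ∃ f : ℝ × ℝ → X, Continuous f ∧ EqOn f g (sphere 0 1) := by
  have abs_le_two (t : I) : |4 * (t : ℝ) - 2| ≤ 2 :=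
    abs_le.2 ⟨by linarith [t.2.1], by linarith [t.2.2]⟩
  let side (ε : ℝ) (hε : |ε| = 1) : Path (g (-1, -1)) (g (1, 1)) :=
    { toFun t := g (antidiagonalPoint ε (4 * t - 2))
      continuous_toFun := hg.comp_continuous (by unfold antidiagonalPoint; fun_prop)
        fun t ↦ antidiagonalPoint_mem_sphere hε (abs_le_two t)
      source' := by norm_num [antidiagonalPoint]
      target' := by norm_num [antidiagonalPoint] }
  obtain ⟨H⟩ := SimplyConnectedSpace.paths_homotopic (side 1 abs_one) (side (-1) (by simp))
  obtain ⟨f, hf, hside⟩ := exists_continuous_antidiagonalPoint_eq H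
  refine ⟨f, hf, fun p hp ↦ ?_⟩
  obtain ⟨t, rfl | rfl⟩ := exists_eq_antidiagonalPoint_of_mem_sphere hp
  · exact (hside t).1
  · exact (hside t).2

end ContinuousFilling

section UniformFilling

variable {X : Type*} [MetricSpace X]

theorem SquareLoopsFill.exists_lipschitzWith_of_near {K C : ℝ≥0} (hK : 0 < K)
    (h : SquareLoopsFill X (1 / 2 * (3 * (3 * K))) (1 / 2 * C)) (hX : IsLengthSpace X) (R : ℝ≥0)
    {f : ℝ × ℝ → X} (hf : UniformContinuous f) :
    ∃ M : ℝ≥0, ∀ g : ℝ × ℝ → X, LipschitzOnWith R g (sphere 0 1) →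
      (∀ p ∈ sphere 0 1, dist (f p) (g p) ≤ K) →
      ∃ F : ℝ × ℝ → X, LipschitzWith M F ∧ EqOn F g (sphere 0 1) := by
  obtain ⟨δ, hδ, hfδ⟩ := Metric.uniformContinuous_iff.1 hf K hK
  obtain ⟨N, hN⟩ := exists_nat_gt (max (1 / δ) (R / K : ℝ))
  obtain ⟨hNδ, hNR⟩ := max_lt_iff.1 hN
  have hN0 : (0 : ℝ) < N := (one_div_pos.2 hδ).trans hNδ
  have lipschitzWith_smul (a : ℝ≥0) : LipschitzWith a fun p : ℝ × ℝ ↦ (a : ℝ) • p := by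
    simpa using lipschitzWith_smul (β := ℝ × ℝ) (a : ℝ)
  set a : ℝ≥0 := (N : ℝ≥0)⁻¹ with ha
  have ha_coe : (a : ℝ) = (N : ℝ)⁻¹ := by simp [ha]
  have smul_mem : MapsTo (fun p : ℝ × ℝ ↦ (a : ℝ) • p) (sphere 0 N) (sphere 0 1) := fun p hp ↦ by
    rw [mem_sphere_zero_iff_norm] at hp ⊢
    rw [norm_smul, hp, ha_coe, norm_inv, Real.norm_natCast, inv_mul_cancel₀ hN0.ne']
  refine ⟨(C + C) * N, fun g hg hfg ↦ ?_⟩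
  have hgK : LipschitzOnWith K (fun p ↦ g ((a : ℝ) • p)) (sphere 0 N) := by
    refine (hg.comp (lipschitzWith_smul a).lipschitzOnWith smul_mem).weaken ?_
    rw [← NNReal.coe_le_coe, NNReal.coe_mul, ha_coe, ← div_eq_mul_inv,
      div_le_iff₀' hN0, ← div_le_iff₀ (NNReal.coe_pos.2 hK)]
    exact hNR.le
  have hfK (p q : ℝ × ℝ) (hpq : dist p q ≤ 1) : dist (f ((a : ℝ) • p)) (f ((a : ℝ) • q)) ≤ K := by
    refine (hfδ (((lipschitzWith_smul a).dist_le_mul p q).trans_lt ?_)).le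
    rw [ha_coe]
    exact (mul_le_of_le_one_right (by positivity) hpq).trans_lt
      (inv_lt_of_inv_lt₀ hδ (by rwa [← one_div]))
  obtain ⟨F, hF, hFg⟩ := h.exists_filling_of_coarse_filling hX hK hgK hfK
    fun p hp ↦ hfg _ (smul_mem hp)
  refine ⟨fun p ↦ F ((N : ℝ) • p), hF.comp (by simpa using lipschitzWith_smul N), fun p hp ↦ ?_⟩
  have hNp : (N : ℝ) • p ∈ sphere 0 (N : ℝ) := by
    rw [mem_sphere_zero_iff_norm] at hp ⊢
    rw [norm_smul, hp, Real.norm_natCast, mul_one]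
  simp only [hFg hNp, ha_coe, inv_smul_smul₀ hN0.ne']

theorem isCompact_setOf_lipschitzWith [ProperSpace X] {α : Type*} [MetricSpace α] (K : ℝ≥0)
    (a : α) (x : X) : IsCompact {u : C(α, X) | LipschitzWith K u ∧ u a = x} := by
  refine ArzelaAscoli.isCompact_of_equicontinuous _ ?_
    (LipschitzWith.uniformEquicontinuous _ K fun u ↦ u.2.1).equicontinuous
  have himage : ContinuousMap.toFun '' {u : C(α, X) | LipschitzWith K u ∧ u a = x} =
      {u : α → X | LipschitzWith K u ∧ u a = x} := by
    ext u
    exact ⟨fun ⟨_, hv, hvu⟩ ↦ hvu ▸ hv, fun hu ↦ ⟨⟨u, hu.1.continuous⟩, hu, rfl⟩⟩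
  rw [himage]
  refine (isCompact_univ_pi fun b ↦ isCompact_closedBall x (K * dist b a)).of_isClosed_subset
    ((isClosed_setOfPred_lipschitzWith K).inter
      (isClosed_eq (continuous_apply a) continuous_const)) fun u hu b _ ↦ ?_
  exact hu.2 ▸ hu.1.dist_le_mul b a

theorem SquareLoopsFill.eventually_exists_lipschitzWith [SimplyConnectedSpace X] {K C : ℝ≥0}
    (hK : 0 < K) (h : SquareLoopsFill X (1 / 2 * (3 * (3 * K))) (1 / 2 * C))
    (hX : IsLengthSpace X) (R : ℝ≥0) (u : C(sphere (0 : ℝ × ℝ) 1, X)) :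
    ∃ M : ℝ≥0, ∀ᶠ v : C(sphere (0 : ℝ × ℝ) 1, X) in 𝓝 u, LipschitzWith R v →
      ∃ F : ℝ × ℝ → X, LipschitzWith M F ∧ ∀ p : sphere (0 : ℝ × ℝ) 1, F p = v p := by
  obtain ⟨x₀⟩ : Nonempty X := inferInstance
  have : CompactSpace (sphere (0 : ℝ × ℝ) 1) := isCompact_iff_compactSpace.1 (isCompact_sphere 0 1)
  let ext (v : C(sphere (0 : ℝ × ℝ) 1, X)) : ℝ × ℝ → X :=
    Function.extend Subtype.val v fun _ ↦ x₀
  have ext_coe (v) (p : sphere (0 : ℝ × ℝ) 1) : ext v p = v p :=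
    Subtype.val_injective.extend_apply _ _ p
  have restrict_ext (v) : (sphere (0 : ℝ × ℝ) 1).domRestrict (ext v) = v := funext (ext_coe v)
  obtain ⟨f, hf, hfu⟩ := exists_continuous_eqOn_sphere (g := ext u) <| by
    rw [continuousOn_iff_continuous_domRestrict, restrict_ext]
    exact u.continuous
  have hf_unif : UniformContinuous (f ∘ clampSquare 1) := by
    have hclamp := (clampSquare.lipschitzWith 1).uniformContinuous.uniformContinuousOn (s := univ)
    exact uniformContinuousOn_univ.1 <|
      ((isCompact_closedBall 0 1).uniformContinuousOn_of_continuous hf.continuousOn).comp hclamp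
        fun p _ ↦ by simp [clampSquare.norm_eq]
  obtain ⟨M, hM⟩ := h.exists_lipschitzWith_of_near hK hX R hf_unif
  refine ⟨M, ?_⟩
  filter_upwards [closedBall_mem_nhds u (NNReal.coe_pos.2 hK)] with v hv hvR
  obtain ⟨F, hF, hFv⟩ := hM (ext v) (by rwa [lipschitzOnWith_iff_restrict, restrict_ext])
    fun p hp ↦ by
      rw [Function.comp_apply, clampSquare.eq_self (mem_sphere_zero_iff_norm.1 hp).le, hfu hp,
        ext_coe u ⟨p, hp⟩, ext_coe v ⟨p, hp⟩, dist_comm]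
      exact (ContinuousMap.dist_apply_le_dist _).trans hv
  exact ⟨F, hF, fun p ↦ by rw [hFv p.2, ext_coe]⟩

theorem IsHomogeneousMetricSpace.exists_squareLoopsFill [ProperSpace X] [SimplyConnectedSpace X]
    (hX : IsHomogeneousMetricSpace X) (hlen : IsLengthSpace X) {K C : ℝ≥0} (hK : 0 < K)
    (h : SquareLoopsFill X (1 / 2 * (3 * (3 * K))) (1 / 2 * C)) (R : ℝ≥0) :
    ∃ M : ℝ≥0, SquareLoopsFill X R M := by
  obtain ⟨x₀⟩ : Nonempty X := inferInstance
  let base : sphere (0 : ℝ × ℝ) 1 := ⟨(1, 0), by simp [Prod.norm_def]⟩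
  obtain ⟨M, hM⟩ : ∃ M : ℝ≥0, ∀ u ∈ {u : C(sphere (0 : ℝ × ℝ) 1, X) | LipschitzWith R u ∧
      u base = x₀}, LipschitzWith R u →
      ∃ F : ℝ × ℝ → X, LipschitzWith M F ∧ ∀ p : sphere (0 : ℝ × ℝ) 1, F p = u p := by
    refine (isCompact_setOf_lipschitzWith R base x₀).induction_on ⟨0, by simp⟩
      (fun T T' hT ⟨M, hM⟩ ↦ ⟨M, fun u hu ↦ hM u (hT hu)⟩) ?_ fun u _ ↦ ?_
    · rintro T T' ⟨M, hM⟩ ⟨M', hM'⟩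
      refine ⟨max M M', fun u hu huR ↦ ?_⟩
      rcases hu with hu | hu
      · exact (hM u hu huR).imp fun F hF ↦ ⟨hF.1.weaken (le_max_left _ _), hF.2⟩
      · exact (hM' u hu huR).imp fun F hF ↦ ⟨hF.1.weaken (le_max_right _ _), hF.2⟩
    · obtain ⟨M, hM⟩ := h.eventually_exists_lipschitzWith hK hlen R u
      exact ⟨_, mem_nhdsWithin_of_mem_nhds hM, M, fun v hv ↦ hv⟩
  refine ⟨M, hX.squareLoopsFill x₀ fun g hg hg₀ ↦ ?_⟩
  have hgR := lipschitzOnWith_iff_restrict.1 hg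
  obtain ⟨F, hF, hFg⟩ := hM ⟨_, hgR.continuous⟩ ⟨hgR, hg₀⟩ hgR
  exact ⟨F, hF, fun p hp ↦ hFg ⟨p, hp⟩⟩

end UniformFilling

section RadialRescale

open NormedSpace

variable {E F : Type*} [NormedAddCommGroup E] [NormedSpace ℝ E] [NormedAddCommGroup F]
  [NormedSpace ℝ F]

theorem norm_normalize_le_one (x : E) : ‖normalize x‖ ≤ 1 := by
  rcases eq_or_ne x 0 with rfl | hx
  · simp
  · exact (norm_normalize_eq_one_iff.2 hx).le

theorem norm_mul_norm_normalize_sub_normalize_le (x y : E) :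
    ‖y‖ * ‖normalize x - normalize y‖ ≤ 2 * ‖x - y‖ := by
  have hsplit : ‖y‖ • (normalize x - normalize y) = (‖y‖ - ‖x‖) • normalize x + (x - y) := by
    rw [smul_sub, sub_smul, norm_smul_normalize, norm_smul_normalize]
    abel
  calc ‖y‖ * ‖normalize x - normalize y‖
      = ‖(‖y‖ - ‖x‖) • normalize x + (x - y)‖ := by rw [← hsplit, norm_smul, norm_norm]
    _ ≤ |‖y‖ - ‖x‖| * ‖normalize x‖ + ‖x - y‖ := by
      rw [← Real.norm_eq_abs, ← norm_smul]
      exact norm_add_le _ _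
    _ ≤ ‖x - y‖ * 1 + ‖x - y‖ := by
      gcongr
      · rw [norm_sub_rev]
        exact abs_norm_sub_norm_le y x
      · exact norm_normalize_le_one x
    _ = 2 * ‖x - y‖ := by ring

/-- The norm-preserving map that agrees with the linear isomorphism `e` up to a positive factor. It
identifies the Euclidean disk with the square, matching their boundaries. -/
noncomputable def radialRescale (e : E ≃L[ℝ] F) (x : E) : F := ‖x‖ • normalize (e x)

theorem norm_radialRescale (e : E ≃L[ℝ] F) (x : E) : ‖radialRescale e x‖ = ‖x‖ := by
  rcases eq_or_ne x 0 with rfl | hx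
  · simp [radialRescale]
  · rw [radialRescale, norm_smul, norm_norm, norm_normalize_eq_one_iff.2 (by simpa using hx),
      mul_one]

theorem radialRescale_symm_radialRescale (e : E ≃L[ℝ] F) (x : E) :
    radialRescale e.symm (radialRescale e x) = x := by
  rcases eq_or_ne x 0 with rfl | hx
  · simp [radialRescale]
  have hpos : 0 < ‖x‖ * ‖e x‖⁻¹ := mul_pos (norm_pos_iff.2 hx) (inv_pos.2 (by simpa using hx))
  calc radialRescale e.symm (radialRescale e x)
      = ‖x‖ • normalize (e.symm ((‖x‖ * ‖e x‖⁻¹) • e x)) := by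
        rw [radialRescale, norm_radialRescale, mul_smul]
        rfl
    _ = x := by
        rw [map_smul, e.symm_apply_apply, normalize_smul_of_pos hpos, norm_smul_normalize]

theorem exists_lipschitzWith_radialRescale (e : E ≃L[ℝ] F) :
    ∃ K : ℝ≥0, LipschitzWith K (radialRescale e) := by
  set A := ‖(e : E →L[ℝ] F)‖₊
  set B := ‖(e.symm : F →L[ℝ] E)‖₊
  have hA (x : E) : ‖e x‖ ≤ A * ‖x‖ := (e : E →L[ℝ] F).le_opNorm x
  have hB (x : E) : ‖x‖ ≤ B * ‖e x‖ := by
    simpa [B] using (e.symm : F →L[ℝ] E).le_opNorm (e x)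
  refine ⟨1 + B * (2 * A), LipschitzWith.of_dist_le_mul fun x y ↦ ?_⟩
  rw [dist_eq_norm, dist_eq_norm]
  have hsplit : radialRescale e x - radialRescale e y =
      (‖x‖ - ‖y‖) • normalize (e x) + ‖y‖ • (normalize (e x) - normalize (e y)) := by
    simp only [radialRescale]
    module
  calc ‖radialRescale e x - radialRescale e y‖
      ≤ |‖x‖ - ‖y‖| * ‖normalize (e x)‖ + ‖y‖ * ‖normalize (e x) - normalize (e y)‖ := by
        rw [hsplit, ← Real.norm_eq_abs, ← norm_norm y, ← norm_smul, ← norm_smul]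
        simpa using norm_add_le _ _
    _ ≤ ‖x - y‖ * 1 + B * ‖e y‖ * ‖normalize (e x) - normalize (e y)‖ := by
        gcongr
        · exact abs_norm_sub_norm_le x y
        · exact norm_normalize_le_one _
        · exact hB y
    _ ≤ ‖x - y‖ + B * (2 * (A * ‖x - y‖)) := by
        rw [mul_one, mul_assoc]
        refine add_le_add_right (mul_le_mul_of_nonneg_left ?_ B.2) _
        refine (norm_mul_norm_normalize_sub_normalize_le _ _).trans ?_
        rw [← map_sub]
        exact mul_le_mul_of_nonneg_left (hA _) zero_le_two
    _ = ↑(1 + B * (2 * A)) * ‖x - y‖ := by push_cast; ring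

end RadialRescale

section DiskSquare

variable {X : Type*} [MetricSpace X]

theorem lipConst_le {A : Type*} [MetricSpace A] {f : A → X} {K : ℝ≥0} (hf : LipschitzWith K f) :
    lipConst f ≤ K :=
  iInf₂_le K hf

theorem exists_lipschitzWith_lipConst_eq {A : Type*} [MetricSpace A] {f : A → X} {K : ℝ≥0}
    (hf : LipschitzWith K f) : ∃ L : ℝ≥0, LipschitzWith L f ∧ lipConst f = L := by
  have hne : lipConst f ≠ ⊤ := ((lipConst_le hf).trans_lt ENNReal.coe_lt_top).ne
  refine ⟨(lipConst f).toNNReal, fun x y ↦ ?_, (ENNReal.coe_toNNReal hne).symm⟩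
  rw [ENNReal.coe_toNNReal hne]
  rcases eq_or_ne (edist x y) 0 with h0 | h0
  · simpa [h0] using hf x y
  rw [← ENNReal.div_le_iff h0 (edist_ne_top x y)]
  exact le_iInf₂ fun K' hK' ↦ (ENNReal.div_le_iff h0 (edist_ne_top x y)).2 (hK' x y)

theorem exists_lipschitzWith_of_fillingSpan_lt {γ : UnitCircle → X} {M : ℝ≥0}
    (h : fillingSpan γ < M) : ∃ f : UnitDisk → X, LipschitzWith M f ∧ f ∘ circleToDisk = γ := by
  simp only [fillingSpan, lipConst, iInf_lt_iff] at h
  obtain ⟨f, hfγ, K, hK, hKM⟩ := h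
  exact ⟨f, hK.weaken (ENNReal.coe_lt_coe.1 hKM).le, hfγ⟩

theorem LipschitzOneConnected.exists_squareLoopsFill (hX : LipschitzOneConnected X) :
    ∃ C : ℝ≥0, ∀ L, SquareLoopsFill X L (C * L) := by
  obtain ⟨C, hC⟩ := hX
  let e := Complex.equivRealProdCLM.symm
  obtain ⟨A, hA⟩ := exists_lipschitzWith_radialRescale e
  obtain ⟨B, hB⟩ := exists_lipschitzWith_radialRescale e.symm
  refine ⟨(C + 1) * (B + 1) * A, fun L g hg ↦ ?_⟩
  rcases eq_or_ne L 0 with rfl | hL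
  · have hbase : ((1, 0) : ℝ × ℝ) ∈ sphere 0 1 := by simp [Prod.norm_def]
    exact ⟨fun _ ↦ g (1, 0), by simp,
      fun p hp ↦ dist_le_zero.1 (by simpa using hg.dist_le_mul _ hbase _ hp)⟩
  have mem_sphere (z : UnitCircle) : radialRescale e.symm z ∈ sphere (0 : ℝ × ℝ) 1 := by
    simp [norm_radialRescale]
  let γ : UnitCircle → X := fun z ↦ g (radialRescale e.symm z)
  have hγ : LipschitzWith (L * (B + 1)) γ := by
    have := hg.comp (s := univ) (hB.comp (LipschitzWith.subtype_val _)).lipschitzOnWith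
      fun z _ ↦ mem_sphere z
    refine (lipschitzOnWith_univ.1 this).weaken ?_
    gcongr
    simp
  have hspan : fillingSpan γ < ((C + 1) * (L * (B + 1)) : ℝ≥0) := by
    refine (hC γ ⟨_, hγ⟩).trans_lt ((mul_le_mul_right (lipConst_le hγ) _).trans_lt ?_)
    rw [← ENNReal.coe_mul, ENNReal.coe_lt_coe, add_one_mul C]
    exact lt_add_of_pos_right _ (by positivity)
  obtain ⟨f, hf, hfγ⟩ := exists_lipschitzWith_of_fillingSpan_lt hspan
  have mem_disk (p : ℝ × ℝ) : radialRescale e (clampSquare 1 p) ∈ closedBall (0 : ℂ) 1 := by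
    simp [norm_radialRescale, clampSquare.norm_eq]
  refine ⟨fun p ↦ f ⟨_, mem_disk p⟩, ?_, fun p hp ↦ ?_⟩
  · refine (hf.comp ((hA.comp (clampSquare.lipschitzWith 1)).subtype_mk mem_disk)).weaken ?_
    exact le_of_eq (by ring)
  · rw [mem_sphere_zero_iff_norm] at hp
    have := congrFun hfγ ⟨radialRescale e p, by simp [norm_radialRescale, hp]⟩
    have hp' : radialRescale e.symm (radialRescale e p) = p := radialRescale_symm_radialRescale e p
    simpa [clampSquare.eq_self hp.le, hp', γ, circleToDisk] using this

theorem lipschitzOneConnected_of_squareLoopsFill {C : ℝ≥0}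
    (h : ∀ L, SquareLoopsFill X L (C * L)) : LipschitzOneConnected X := by
  let e := Complex.equivRealProdCLM
  obtain ⟨A, hA⟩ := exists_lipschitzWith_radialRescale e
  obtain ⟨B, hB⟩ := exists_lipschitzWith_radialRescale e.symm
  refine ⟨C * B * A, fun γ ⟨K, hK⟩ ↦ ?_⟩
  obtain ⟨L, hL, hLγ⟩ := exists_lipschitzWith_lipConst_eq hK
  have hmem (p : sphere (0 : ℝ × ℝ) 1) : radialRescale e.symm p ∈ sphere (0 : ℂ) 1 := by
    simp [norm_radialRescale]
  have hγ : LipschitzWith (L * B) fun p : sphere (0 : ℝ × ℝ) 1 ↦ γ ⟨_, hmem p⟩ := by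
    have := hL.comp ((hB.comp (LipschitzWith.subtype_val _)).subtype_mk hmem)
    rwa [mul_one] at this
  obtain ⟨g, hgγ⟩ : ∃ g : ℝ × ℝ → X, ∀ p : sphere (0 : ℝ × ℝ) 1, g p = γ ⟨_, hmem p⟩ :=
    ⟨Function.extend Subtype.val _ fun _ ↦ γ 1, Subtype.val_injective.extend_apply _ _⟩
  have hg : LipschitzOnWith (L * B) g (sphere 0 1) := fun p hp q hq ↦ by
    simpa only [hgγ ⟨p, hp⟩, hgγ ⟨q, hq⟩, Subtype.edist_eq] using hγ ⟨p, hp⟩ ⟨q, hq⟩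
  obtain ⟨f, hf, hfg⟩ := h _ g hg
  let F : UnitDisk → X := fun z ↦ f (radialRescale e z)
  have hfill : LipschitzWith (C * (L * B) * A) F := by
    have := hf.comp (hA.comp (LipschitzWith.subtype_val (closedBall 0 1)))
    rwa [mul_one] at this
  have hrestr : F ∘ circleToDisk = γ := by
    funext z
    have hz : radialRescale e z ∈ sphere (0 : ℝ × ℝ) 1 := by simp [norm_radialRescale]
    change f (radialRescale e z) = γ z
    rw [hfg hz, hgγ ⟨_, hz⟩]
    simp only [radialRescale_symm_radialRescale]
  calc fillingSpan γ ≤ lipConst F := iInf₂_le F hrestr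
    _ ≤ (C * (L * B) * A : ℝ≥0) := lipConst_le hfill
    _ = (C * B * A : ℝ≥0) * lipConst γ := by
      rw [hLγ, ← ENNReal.coe_mul]
      ring_nf

end DiskSquare

section BoundaryInterpolation

variable {Y : Type*} [MetricSpace Y] {K : ℝ≥0}

theorem IsLengthSpace.exists_lipschitzWith_near (hY : IsLengthSpace Y) {u : ℝ → Y}
    (hu : ∀ s t, dist s t ≤ 1 → dist (u s) (u t) < K) :
    ∃ p : ℝ → Y, LipschitzWith K p ∧ (∀ k : ℤ, p k = u k) ∧ ∀ t, dist (p t) (u t) ≤ 2 * K := by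
  obtain ⟨p, hp, hpu⟩ := hY.exists_lipschitzWith_interpolation (u := fun k : ℤ ↦ u k)
    fun k ↦ hu k (k + 1 : ℤ) (by simp)
  refine ⟨p, hp, hpu, fun t ↦ ?_⟩
  have hfloor : dist t ⌊t⌋ ≤ 1 := by
    rw [Real.dist_eq, Int.self_sub_floor, Int.abs_fract]
    exact (Int.fract_lt_one t).le
  calc dist (p t) (u t) ≤ dist (p t) (p ⌊t⌋) + dist (p ⌊t⌋) (u t) := dist_triangle _ _ _
    _ ≤ K * 1 + K := by
      refine add_le_add ((hp.dist_le_mul _ _).trans (by gcongr)) ?_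
      rw [hpu, dist_comm]
      exact (hu _ _ hfloor).le
    _ = 2 * K := by ring

theorem IsLengthSpace.exists_lipschitzOnWith_sphere_near (hY : IsLengthSpace Y) {N : ℕ}
    {h : ℝ × ℝ → Y} (hh : ∀ p ∈ sphere 0 (N : ℝ), ∀ q ∈ sphere 0 (N : ℝ), dist p q ≤ 1 →
      dist (h p) (h q) < K) :
    ∃ b : ℝ × ℝ → Y, LipschitzOnWith (3 * K) b (sphere 0 N) ∧
      ∀ p ∈ sphere 0 (N : ℝ), dist (b p) (h p) ≤ 2 * K := by
  classical
  have : Nonempty (ℝ → Y) := ⟨fun _ ↦ h 0⟩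
  have exists_side {ℓ : ℝ → ℝ × ℝ} (hℓ : LipschitzWith 1 ℓ) (hN : ∀ t, N ≤ ‖ℓ t‖) :
      ∃ p : ℝ → Y, LipschitzWith K p ∧ (∀ k : ℤ, p k = h (clampSquare N (ℓ k))) ∧
        ∀ t, dist (p t) (h (clampSquare N (ℓ t))) ≤ 2 * K := by
    refine hY.exists_lipschitzWith_near (u := fun t ↦ h (clampSquare N (ℓ t)))
      fun s t hst ↦ hh _ ?_ _ ?_ ?_
    · exact clampSquare.mem_sphere N.cast_nonneg (hN s)
    · exact clampSquare.mem_sphere N.cast_nonneg (hN t)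
    · refine (((clampSquare.lipschitzWith N).comp hℓ).dist_le_mul s t).trans ?_
      simpa using hst
  choose! hor hhor hor_int hor_near using fun (y : ℝ) (hy : |y| = N) ↦
    exists_side (LipschitzWith.prodMk_right y) fun x ↦ hy.symm.trans_le (norm_snd_le (x, y))
  choose! ver hver ver_int ver_near using fun (x : ℝ) (hx : |x| = N) ↦
    exists_side (LipschitzWith.prodMk_left x) fun y ↦ hx.symm.trans_le (norm_fst_le (x, y))
  set b : ℝ × ℝ → Y := fun p ↦ if |p.2| = N then hor p.2 p.1 else ver p.1 p.2
  have b_hor {x y : ℝ} (hy : |y| = N) : b (x, y) = hor y x := if_pos hy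
  have b_ver {x y : ℝ} (hx : |x| = N) : b (x, y) = ver x y := by
    by_cases hy : |y| = N
    · obtain ⟨i, rfl⟩ := exists_intCast_eq_of_abs_eq_natCast hx
      obtain ⟨j, rfl⟩ := exists_intCast_eq_of_abs_eq_natCast hy
      rw [b_hor hy, hor_int _ hy, ver_int _ hx]
    · exact if_neg hy
  refine ⟨b, lipschitzOnWith_sphere_of_sides (fun y hy ↦ ?_) (fun x hx ↦ ?_), fun ⟨x, y⟩ hp ↦ ?_⟩
  · simp only [Prod.snd_zero, sub_zero] at hy
    simpa only [b_hor hy] using hhor y hy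
  · simp only [Prod.fst_zero, sub_zero] at hx
    simpa only [b_ver hx] using hver x hx
  · rw [mem_sphere_zero_iff_norm] at hp
    have hclamp := clampSquare.eq_self hp.le
    rw [Prod.norm_def, Real.norm_eq_abs, Real.norm_eq_abs] at hp
    rcases max_choice |x| |y| with hmax | hmax
    · rw [b_ver (hmax.symm.trans hp)]
      simpa only [hclamp] using ver_near x (hmax.symm.trans hp) y
    · rw [b_hor (hmax.symm.trans hp)]
      simpa only [hclamp] using hor_near y (hmax.symm.trans hp) x

end BoundaryInterpolation

section QuasiIsometry

variable {X Y : Type*} [MetricSpace X] [MetricSpace Y]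

theorem QuasiIsometric.exists_quasiInverse (h : QuasiIsometric X Y) :
    ∃ (ψ : X → Y) (φ : Y → X) (K c : ℝ≥0), (∀ x x', dist (ψ x) (ψ x') ≤ K * dist x x' + c) ∧
      (∀ y y', dist (φ y) (φ y') ≤ K * dist y y' + c) ∧ ∀ x, dist (φ (ψ x)) x ≤ c := by
  obtain ⟨ψ, K, c, hK, hc, hψ, hdense⟩ := h
  lift K to ℝ≥0 using zero_le_one.trans hK
  lift c to ℝ≥0 using hc
  choose φ hφ using hdense
  have hlow (x x' : X) : dist x x' ≤ K * (dist (ψ x) (ψ x') + c) := by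
    rw [← inv_mul_le_iff₀ (zero_lt_one.trans_le hK), ← sub_le_iff_le_add]
    exact (hψ x x').1
  have hKc : (c : ℝ) ≤ K * c := le_mul_of_one_le_left c.2 hK
  refine ⟨ψ, φ, K, 3 * (K * c), fun x x' ↦ ?_, fun y y' ↦ ?_, fun x ↦ ?_⟩ <;> push_cast
  · linarith [(hψ x x').2]
  · calc dist (φ y) (φ y') ≤ K * (dist (ψ (φ y)) (ψ (φ y')) + c) := hlow _ _
      _ ≤ K * (c + dist y y' + c + c) := by
        gcongr
        refine (dist_triangle4 _ y y' _).trans ?_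
        gcongr
        exacts [hφ y, dist_comm y' _ ▸ hφ y']
      _ = K * dist y y' + 3 * (K * c) := by ring
  · calc dist (φ (ψ x)) x ≤ K * (dist (ψ (φ (ψ x))) (ψ x) + c) := hlow _ _
      _ ≤ K * (c + c) := by gcongr; exact hφ _
      _ ≤ 3 * (K * c) := by linarith

theorem QuasiIsometric.exists_coarse_filling (hXY : QuasiIsometric X Y) (hY : IsLengthSpace Y)
    (hfill : LipschitzOneConnected Y) :
    ∃ K : ℝ≥0, 1 ≤ K ∧ ∀ N : ℕ, 0 < N → ∀ g : ℝ × ℝ → X, LipschitzOnWith 1 g (sphere 0 N) →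
      ∃ w : ℝ × ℝ → X, (∀ p q, dist p q ≤ 1 → dist (w p) (w q) ≤ K) ∧
        ∀ p ∈ sphere 0 (N : ℝ), dist (w p) (g p) ≤ K := by
  obtain ⟨ψ, φ, K, c, hψ, hφ, hφψ⟩ := hXY.exists_quasiInverse
  obtain ⟨C, hC⟩ := hfill.exists_squareLoopsFill
  set D := K + c + 1 with hD
  refine ⟨1 + (K * (C * (3 * D)) + c) + (K * (2 * D) + c + c), by
    rw [add_assoc]; exact le_self_add, fun N hN g hg ↦ ?_⟩
  obtain ⟨b, hb, hbg⟩ := hY.exists_lipschitzOnWith_sphere_near (K := D) (h := ψ ∘ g)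
    fun p hp q hq hpq ↦ by
      have hgpq : dist (g p) (g q) ≤ 1 := by
        simpa using (hg.dist_le_mul p hp q hq).trans (by simpa using hpq)
      calc dist (ψ (g p)) (ψ (g q)) ≤ K * dist (g p) (g q) + c := hψ _ _
        _ ≤ K * 1 + c := by gcongr
        _ < D := by rw [hD]; push_cast; linarith
  obtain ⟨f, hf, hfb⟩ := SquareLoopsFill.rescale (C := C * (3 * D)) (Nat.cast_pos.2 hN)
    (by simpa only [mul_left_comm] using hC (N * (3 * D))) 0 hb
  refine ⟨φ ∘ f, fun p q hpq ↦ ?_, fun p hp ↦ ?_⟩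
  · calc dist (φ (f p)) (φ (f q)) ≤ K * dist (f p) (f q) + c := hφ _ _
      _ ≤ K * (C * (3 * D) * 1) + c := by
        gcongr
        exact (hf.dist_le_mul p q).trans (by push_cast; gcongr)
      _ ≤ _ := by
        push_cast
        rw [mul_one, add_comm (1 : ℝ), add_assoc]
        exact le_add_of_nonneg_right (by positivity)
  · calc dist (φ (f p)) (g p) ≤ dist (φ (b p)) (φ (ψ (g p))) + dist (φ (ψ (g p))) (g p) := by
          rw [hfb hp]
          exact dist_triangle _ _ _
      _ ≤ K * (2 * D) + c + c := by
        gcongr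
        · exact (hφ _ _).trans (by gcongr; exact hbg p hp)
        · exact hφψ _
      _ ≤ _ := by
        push_cast
        exact le_add_of_nonneg_left (by positivity)

theorem QuasiIsometric.exists_squareLoopsFill_natCast (hXY : QuasiIsometric X Y)
    (hX : IsLengthSpace X) (hY : IsLengthSpace Y) (hfill : LipschitzOneConnected Y)
    (hall : ∀ R, ∃ M, SquareLoopsFill X R M) :
    ∃ M : ℝ≥0, ∀ N : ℕ, 0 < N → SquareLoopsFill X N (N * M) := by
  obtain ⟨K, hK, hcoarse⟩ := hXY.exists_coarse_filling hY hfill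
  obtain ⟨M, hM⟩ := hall (1 / 2 * (3 * (3 * K)))
  have hM' : SquareLoopsFill X (1 / 2 * (3 * (3 * K))) (1 / 2 * (2 * M)) :=
    hM.mono le_rfl (by simp)
  refine ⟨2 * M + 2 * M, fun N hN ↦ ?_⟩
  rw [← mul_one (N : ℝ≥0), mul_assoc, one_mul]
  refine squareLoopsFill_of_forall_sphere (Nat.cast_pos.2 hN) fun g hg ↦ ?_
  obtain ⟨w, hw, hwg⟩ := hcoarse N hN g hg
  exact hM'.exists_filling_of_coarse_filling hX (zero_lt_one.trans_le hK) (hg.weaken hK) hw hwg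

theorem squareLoopsFill_of_small_of_natCast {ρ C M : ℝ≥0} (hρ : 0 < ρ)
    (hsmall : ∀ L ≤ ρ, SquareLoopsFill X L (C * L))
    (hnat : ∀ N : ℕ, 0 < N → SquareLoopsFill X N (N * M)) (L : ℝ≥0) :
    SquareLoopsFill X L (max C ((1 + ρ⁻¹) * M) * L) := by
  rcases le_or_gt L ρ with hL | hL
  · exact (hsmall L hL).mono le_rfl (by gcongr; exact le_max_left _ _)
  refine (hnat ⌈L⌉₊ (Nat.ceil_pos.2 (hρ.trans hL))).mono (Nat.le_ceil L) ?_
  calc ⌈L⌉₊ * M ≤ (L + ρ⁻¹ * L) * M := by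
        gcongr
        have hρL : 1 ≤ ρ⁻¹ * L := by
          rw [← inv_mul_cancel₀ hρ.ne']
          gcongr
        exact (Nat.ceil_lt_add_one zero_le).le.trans (by gcongr)
    _ = (1 + ρ⁻¹) * M * L := by ring
    _ ≤ max C ((1 + ρ⁻¹) * M) * L := by gcongr; exact le_max_right _ _

end QuasiIsometry

theorem isContinuousRiemannianBundle_of_isContMDiffRiemannianBundle
    {E H B F : Type*} [NormedAddCommGroup E] [NormedSpace ℝ E] [TopologicalSpace H]
    (I : ModelWithCorners ℝ E H) (k : ℕ∞ω) [TopologicalSpace B] [ChartedSpace H B]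
    [NormedAddCommGroup F] [NormedSpace ℝ F] {V : B → Type*}
    [TopologicalSpace (Bundle.TotalSpace F V)] [∀ x, NormedAddCommGroup (V x)]
    [∀ x, InnerProductSpace ℝ (V x)] [FiberBundle F V] [VectorBundle ℝ F V]
    [h : IsContMDiffRiemannianBundle I k F V] : IsContinuousRiemannianBundle F V :=
  let ⟨g, hg, hg_inner⟩ := h.exists_contMDiff
  ⟨g, hg.continuous, hg_inner⟩

theorem proposition3p6_general {E H : Type*} [NormedAddCommGroup E] [NormedSpace ℝ E]
    [FiniteDimensional ℝ E] [TopologicalSpace H] (I : ModelWithCorners ℝ E H) [I.Boundaryless]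
    {X : Type*} [MetricSpace X] [ChartedSpace H X] [IsManifold I 1 X]
    [Bundle.RiemannianBundle (fun x : X ↦ TangentSpace I x)]
    [IsContinuousRiemannianBundle E (fun x : X ↦ TangentSpace I x)] [IsRiemannianManifold I X]
    [SimplyConnectedSpace X] {Y : Type*} [MetricSpace Y] (hX : IsHomogeneousMetricSpace X)
    (hY : IsLengthSpace Y) (hXY : QuasiIsometric X Y) (hfill : LipschitzOneConnected Y) :
    LipschitzOneConnected X := by
  have hlen : IsLengthSpace X := isLengthSpace_of_isRiemannianManifold I X
  have : LocallyCompactSpace X := Manifold.locallyCompact_of_finiteDimensional I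
  have : ProperSpace X := hX.properSpace hlen
  obtain ⟨ρ, hρ, C, hsmall⟩ := hX.exists_squareLoopsFill_small I
  have hall (R : ℝ≥0) : ∃ M, SquareLoopsFill X R M :=
    hX.exists_squareLoopsFill hlen (K := 2 / 9 * ρ) (C := 2 * (C * ρ)) (by positivity)
      ((hsmall ρ le_rfl).mono (by ring_nf; rfl) (by simp)) R
  obtain ⟨M, hnat⟩ := hXY.exists_squareLoopsFill_natCast hlen hY hfill hall
  exact lipschitzOneConnected_of_squareLoopsFill
    (squareLoopsFill_of_small_of_natCast hρ hsmall hnat)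

theorem proposition3p6
    {n m : ℕ}
    {X : Type*} [MetricSpace X] [ChartedSpace (EuclideanSpace ℝ (Fin n)) X]
    [IsManifold (𝓡 n) ∞ X]
    [Bundle.RiemannianBundle (fun x : X ↦ TangentSpace (𝓡 n) x)]
    [IsContMDiffRiemannianBundle (𝓡 n) ∞ (EuclideanSpace ℝ (Fin n))
      (fun x : X ↦ TangentSpace (𝓡 n) x)]
    [IsRiemannianManifold (𝓡 n) X]
    [CompleteSpace X] [SimplyConnectedSpace X]
    {Y : Type*} [MetricSpace Y] [ChartedSpace (EuclideanSpace ℝ (Fin m)) Y]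
    [IsManifold (𝓡 m) ∞ Y]
    [Bundle.RiemannianBundle (fun y : Y ↦ TangentSpace (𝓡 m) y)]
    [IsContMDiffRiemannianBundle (𝓡 m) ∞ (EuclideanSpace ℝ (Fin m))
      (fun y : Y ↦ TangentSpace (𝓡 m) y)]
    [IsRiemannianManifold (𝓡 m) Y]
    [CompleteSpace Y] [SimplyConnectedSpace Y]
    (hX : IsHomogeneousMetricSpace X) (hY : IsHomogeneousMetricSpace Y)
    (hXY : QuasiIsometric X Y) (hfill : LipschitzOneConnected Y) :
    LipschitzOneConnected X := by
  have : IsManifold (𝓡 n) 1 X := IsManifold.of_le (n := ∞) (by simp)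
  have : IsContinuousRiemannianBundle (EuclideanSpace ℝ (Fin n))
      (fun x : X ↦ TangentSpace (𝓡 n) x) :=
    isContinuousRiemannianBundle_of_isContMDiffRiemannianBundle (𝓡 n) ∞
  exact proposition3p6_general (𝓡 n) hX (isLengthSpace_of_isRiemannianManifold (𝓡 m) Y) hXY hfill
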